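/- Let $n\ge 2$, $1\le p\le\infty$, $0<s<1$ with $sp\ge n$ (satisfied when $p=\infty$), and $1\le q\le r<\infty$. Let $K,V:\mathbb R^n\to(0,\infty)$ be Lebesgue measurable functions such that - there is some $t\in(1,\infty]$ with $K\in L^t(\Omega)$ for every measurable $\Omega\subset\mathbb R^n$ of finite Lebesgue measure; - $\inf_{\mathbb R^n}V\ge V_0$ for some constant $V_0>0$; - $KV^{-\tau}$ vanishes at infinity, i.e. it is locally integrable and $\{x\in\mathbb R^n: K(x)V(x)^{-\tau}\ge c\}$ has finite Lebesgue measure for each $c>0$, for some $\tau\in(0,1)$ if $q<r$, and for $\tau=1$ if $q=r$. Let $M_V^{s;q,p}(\mathbb R^n)$ be the Banach space obtained as the completion of the set of functions $u\in C^1_c(\mathbb R^n)$ of finite norm with respect to $$\|u\|_{M_V^{s;q,p}(\mathbb R^n)}:=\Bigl(\int_{\mathbb R^n}|u|^qV\,dx\Bigr)^{1/q}+[u]_{s,p},\qquad [u]_{s,p}:=\Bigl(\int_{\mathbb R^n}\int_{\mathbb R^n}\frac{|u(x)-u(y)|^p}{|x-y|^{n+sp}}\,dx\,dy\Bigr)^{1/p},$$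 where $[u]_{s,\infty}:=\operatorname{ess\,sup}_{x\ne y}|u(x)-u(y)|/|x-y|^s$ if $p=\infty$. Let $L^r(K;\mathbb R^n)$ be the space $L^r$ with respect to the measure $K\,dx$. Then $M_V^{s;q,p}(\mathbb R^n)$ embeds compactly into $L^r(K;\mathbb R^n)$: the identity on these functions $u$ extends to an injective compact linear operator $M_V^{s;q,p}(\mathbb R^n)\to L^r(K;\mathbb R^n)$. -/

import Mathlib

open MeasureTheory
open scoped ENNReal

noncomputable section

/-- The Gagliardo quotient `(u x - u y) / |x - y| ^ (n / p + s)`, as a function on `ℝⁿ × ℝⁿ`. For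
`p = ∞` the exponent is `s`, so that this is the Hölder quotient. -/
def gagliardoQuotient (n : ℕ) (s : ℝ) (p : ℝ≥0∞) (u : EuclideanSpace ℝ (Fin n) → ℝ) :
    EuclideanSpace ℝ (Fin n) × EuclideanSpace ℝ (Fin n) → ℝ :=
  fun z => (u z.1 - u z.2) / ‖z.1 - z.2‖ ^ ((n : ℝ) * (p⁻¹).toReal + s)

/-- The weighted Lebesgue measure `w(x) dx` on `ℝⁿ`. -/
def weightedVolume {n : ℕ} (w : EuclideanSpace ℝ (Fin n) → ℝ) :
    Measure (EuclideanSpace ℝ (Fin n)) :=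
  volume.withDensity (fun x => ENNReal.ofReal (w x))

/-- A locally integrable function vanishes at infinity (in the sense of Lieb and Loss) if all the
sets `{|f| ≥ c}`, `c > 0`, have finite Lebesgue measure. -/
def VanishesAtInfinity {n : ℕ} (f : EuclideanSpace ℝ (Fin n) → ℝ) : Prop :=
  LocallyIntegrable f volume ∧ ∀ c : ℝ, 0 < c → volume {x | c ≤ |f x|} < ∞

theorem gagliardoQuotient_add (n : ℕ) (s : ℝ) (p : ℝ≥0∞)
    (u v : EuclideanSpace ℝ (Fin n) → ℝ) :
    gagliardoQuotient n s p (u + v) = gagliardoQuotient n s p u + gagliardoQuotient n s p v := by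
  funext z
  simp only [gagliardoQuotient, Pi.add_apply]
  ring

theorem gagliardoQuotient_smul (n : ℕ) (s : ℝ) (p : ℝ≥0∞) (c : ℝ)
    (u : EuclideanSpace ℝ (Fin n) → ℝ) :
    gagliardoQuotient n s p (c • u) = c • gagliardoQuotient n s p u := by
  funext z
  simp only [gagliardoQuotient, Pi.smul_apply, smul_eq_mul]
  ring

/-- The compactly supported `C¹` functions `u` on `ℝⁿ` with
`(∫ |u|^q V dx)^(1/q) + [u]_{s,p} < ∞`, as a linear subspace of all functions. -/
def mvTestSubmodule (n : ℕ) (s : ℝ) (q p : ℝ≥0∞) (V : EuclideanSpace ℝ (Fin n) → ℝ) :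
    Submodule ℝ (EuclideanSpace ℝ (Fin n) → ℝ) where
  carrier := {u | ContDiff ℝ 1 u ∧ HasCompactSupport u ∧ MemLp u q (weightedVolume V) ∧
    MemLp (gagliardoQuotient n s p u) p volume}
  add_mem' := by
    rintro u v ⟨hu1, hu2, hu3, hu4⟩ ⟨hv1, hv2, hv3, hv4⟩
    refine ⟨hu1.add hv1, hu2.add hv2, hu3.add hv3, ?_⟩
    rw [gagliardoQuotient_add]
    exact hu4.add hv4
  zero_mem' := by
    refine ⟨contDiff_const, HasCompactSupport.zero, MemLp.zero, ?_⟩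
    have h : gagliardoQuotient n s p (0 : EuclideanSpace ℝ (Fin n) → ℝ) = 0 := by
      funext z
      simp [gagliardoQuotient]
    rw [h]
    exact MemLp.zero
  smul_mem' := by
    rintro c u ⟨hu1, hu2, hu3, hu4⟩
    refine ⟨hu1.const_smul c, hu2.smul_left (f := fun _ => c), hu3.const_smul c, ?_⟩
    rw [gagliardoQuotient_smul]
    exact hu4.const_smul c

/-- The space of test functions, as a type of its own (so that it carries the norm below, and not
the topology of pointwise convergence). -/
def MVTest (n : ℕ) (s : ℝ) (q p : ℝ≥0∞) (V : EuclideanSpace ℝ (Fin n) → ℝ) : Type :=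
  mvTestSubmodule n s q p V

instance (n : ℕ) (s : ℝ) (q p : ℝ≥0∞) (V : EuclideanSpace ℝ (Fin n) → ℝ) :
    AddCommGroup (MVTest n s q p V) :=
  inferInstanceAs (AddCommGroup (mvTestSubmodule n s q p V))

instance (n : ℕ) (s : ℝ) (q p : ℝ≥0∞) (V : EuclideanSpace ℝ (Fin n) → ℝ) :
    Module ℝ (MVTest n s q p V) :=
  inferInstanceAs (Module ℝ (mvTestSubmodule n s q p V))

/-- The function on `ℝⁿ` underlying a test function. -/
def MVTest.toFun {n : ℕ} {s : ℝ} {q p : ℝ≥0∞} {V : EuclideanSpace ℝ (Fin n) → ℝ}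
    (u : MVTest n s q p V) : EuclideanSpace ℝ (Fin n) → ℝ :=
  Subtype.val u

/-- The norm `‖u‖ = ‖u‖_{L^q(V)} + [u]_{s,p}` on the test functions. -/
def mvNorm (n : ℕ) (s : ℝ) (q p : ℝ≥0∞) [hq : Fact (1 ≤ q)] [hp : Fact (1 ≤ p)]
    (V : EuclideanSpace ℝ (Fin n) → ℝ) : Seminorm ℝ (MVTest n s q p V) :=
  Seminorm.of
    (fun u => (eLpNorm u.toFun q (weightedVolume V)).toReal +
      (eLpNorm (gagliardoQuotient n s p u.toFun) p volume).toReal)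
    (by
      rintro ⟨u, hu1, hu2, hu3, hu4⟩ ⟨v, hv1, hv2, hv3, hv4⟩
      change (eLpNorm (u + v) q (weightedVolume V)).toReal +
        (eLpNorm (gagliardoQuotient n s p (u + v)) p volume).toReal ≤
        ((eLpNorm u q (weightedVolume V)).toReal +
          (eLpNorm (gagliardoQuotient n s p u) p volume).toReal) +
        ((eLpNorm v q (weightedVolume V)).toReal +
          (eLpNorm (gagliardoQuotient n s p v) p volume).toReal)
      rw [gagliardoQuotient_add]
      have h1 := ENNReal.toReal_mono (ENNReal.add_ne_top.2 ⟨hu3.2.ne, hv3.2.ne⟩)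
        (eLpNorm_add_le hu3.1 hv3.1 hq.out)
      have h2 := ENNReal.toReal_mono (ENNReal.add_ne_top.2 ⟨hu4.2.ne, hv4.2.ne⟩)
        (eLpNorm_add_le hu4.1 hv4.1 hp.out)
      rw [ENNReal.toReal_add hu3.2.ne hv3.2.ne] at h1
      rw [ENNReal.toReal_add hu4.2.ne hv4.2.ne] at h2
      linarith)
    (by
      rintro c ⟨u, hu⟩
      change (eLpNorm (c • u) q (weightedVolume V)).toReal +
        (eLpNorm (gagliardoQuotient n s p (c • u)) p volume).toReal =
        ‖c‖ * ((eLpNorm u q (weightedVolume V)).toReal +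
          (eLpNorm (gagliardoQuotient n s p u) p volume).toReal)
      rw [gagliardoQuotient_smul, eLpNorm_const_smul, eLpNorm_const_smul, ENNReal.toReal_mul,
        ENNReal.toReal_mul, toReal_enorm, mul_add])

instance (n : ℕ) (s : ℝ) (q p : ℝ≥0∞) [Fact (1 ≤ q)] [Fact (1 ≤ p)]
    (V : EuclideanSpace ℝ (Fin n) → ℝ) : SeminormedAddCommGroup (MVTest n s q p V) :=
  (mvNorm n s q p V).toAddGroupSeminorm.toSeminormedAddCommGroup

instance (n : ℕ) (s : ℝ) (q p : ℝ≥0∞) [Fact (1 ≤ q)] [Fact (1 ≤ p)]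
    (V : EuclideanSpace ℝ (Fin n) → ℝ) : NormedSpace ℝ (MVTest n s q p V) where
  norm_smul_le c u := le_of_eq (map_smul_eq_mul (mvNorm n s q p V) c u)

/-- The Banach space `M_V^{s;q,p}(ℝⁿ)`: the completion of the space of test functions with respect
to the norm `‖u‖_{L^q(V)} + [u]_{s,p}`. -/
abbrev MVSpace (n : ℕ) (s : ℝ) (q p : ℝ≥0∞) [Fact (1 ≤ q)] [Fact (1 ≤ p)]
    (V : EuclideanSpace ℝ (Fin n) → ℝ) : Type :=
  UniformSpace.Completion (MVTest n s q p V)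

end

/-! Everything rests on one consequence of `[u]_{s,p} ≤ 1`: by Hölder on balls, `∫_{B(x,h)} |u x - u
y| dy ≤ C g(x) h^(n+s)` for almost every `x` and every `h > 0`, with `‖g‖_p ≤ 1`
(`exists_oscillation_bound`).

Integrability. If `u` is also bounded in `L^m`, then `|u|` has average at most `|u x|/2` over a ball
of volume comparable to `|u x|^(-m)`, so the oscillation over that ball must supply the other half.
This gives `|u|^(1+ms/n) ≤ C g` almost everywhere (`enorm_rpow_le_of_oscillation`). For finite `p`
an `L^m` bound thus becomes an `L^(p(1+ms/n))` bound, and `sp ≥ n` makes the new exponent at least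
`m + 1`; for `p = ∞` the estimate is a sup bound. Starting from `L^q`, available because `V ≥ V₀`,
every finite exponent `≥ q` is reached (`exists_lintegral_rpow_le`).

Compactness. Off a set `Ω` of finite measure, `K ≤ c V^τ` with `c` small, and `|u|^r V^τ ≤ |u|^q V +
|u|^m`, so the tails are uniformly small. On `Ω`, Hölder against `K ∈ L^t` reduces the matter to
unweighted norms. There `u` is close to its truncation, and the truncation to truncated averages
over finitely many small balls. Hence the unit ball lies uniformly near compact sets of step
functions (`exists_uniform_simple_approximation`), and its image is totally bounded.

Injectivity. By Fatou, a Cauchy sequence of test functions tending to zero almost everywhere tends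
to zero in norm (`MVTest.tendsto_norm_of_cauchySeq_of_ae`). -/

/-! ### Oscillation over balls -/

theorem enorm_sub_eq_gagliardoQuotient {n : ℕ} (s : ℝ) (p : ℝ≥0∞)
    (u : EuclideanSpace ℝ (Fin n) → ℝ) (x y : EuclideanSpace ℝ (Fin n)) :
    ‖u x - u y‖ₑ = ‖gagliardoQuotient n s p u (x, y)‖ₑ *
      ENNReal.ofReal (‖x - y‖ ^ ((n : ℝ) * (p⁻¹).toReal + s)) := by
  rcases eq_or_ne x y with rfl | hxy
  · simp [gagliardoQuotient]
  · have h0 : 0 < ‖x - y‖ := norm_pos_iff.2 (sub_ne_zero.2 hxy)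
    have h1 : 0 < ‖x - y‖ ^ ((n : ℝ) * (p⁻¹).toReal + s) := Real.rpow_pos_of_pos h0 _
    rw [← ofReal_norm, ← ofReal_norm, ← ENNReal.ofReal_mul (norm_nonneg _)]
    congr 1
    rw [gagliardoQuotient, norm_div, Real.norm_of_nonneg h1.le, div_mul_cancel₀ _ h1.ne']

theorem measurable_gagliardoQuotient {n : ℕ} (s : ℝ) (p : ℝ≥0∞)
    {u : EuclideanSpace ℝ (Fin n) → ℝ} (hu : Measurable u) :
    Measurable (gagliardoQuotient n s p u) := by
  unfold gagliardoQuotient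
  fun_prop

/-- The volume of the unit ball of `ℝⁿ`. -/
noncomputable def unitBallVolume (n : ℕ) : ℝ :=
  (volume (Metric.ball (0 : EuclideanSpace ℝ (Fin n)) 1)).toReal

theorem unitBallVolume_pos (n : ℕ) : 0 < unitBallVolume n :=
  ENNReal.toReal_pos (Metric.measure_ball_pos _ _ one_pos).ne' measure_ball_lt_top.ne

theorem volume_ball_eq {n : ℕ} (x : EuclideanSpace ℝ (Fin n)) {h : ℝ} (hh : 0 < h) :
    volume (Metric.ball x h) = ENNReal.ofReal (unitBallVolume n * h ^ (n : ℝ)) := by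
  rw [Measure.addHaar_ball_of_pos _ _ hh, finrank_euclideanSpace_fin, mul_comm (unitBallVolume n),
    ENNReal.ofReal_mul (by positivity), unitBallVolume, ENNReal.ofReal_toReal measure_ball_lt_top.ne,
    Real.rpow_natCast]

/-- Hölder on the ball costs `(ω h^n)^(1-1/p)`, and `|x - y| ≤ h` costs `h^(n/p+s)`; the powers of
`h` combine to `h^(n+s)`, free of `p`. -/
theorem setLIntegral_ball_enorm_sub_le {n : ℕ} {s : ℝ} (hs : 0 < s) {p : ℝ≥0∞} (hp : 1 ≤ p)
    {u : EuclideanSpace ℝ (Fin n) → ℝ} (hu : Measurable u) (x : EuclideanSpace ℝ (Fin n))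
    {h : ℝ} (hh : 0 < h) :
    ∫⁻ y in Metric.ball x h, ‖u x - u y‖ₑ ≤
      ENNReal.ofReal (unitBallVolume n ^ (1 - (p⁻¹).toReal)) *
        eLpNorm (fun y => gagliardoQuotient n s p u (x, y)) p volume *
        ENNReal.ofReal (h ^ ((n : ℝ) + s)) := by
  have hm : Measurable fun y => gagliardoQuotient n s p u (x, y) :=
    (measurable_gagliardoQuotient s p hu).comp measurable_prodMk_left
  have hω := unitBallVolume_pos n
  have h1 : ∫⁻ y in Metric.ball x h, ‖gagliardoQuotient n s p u (x, y)‖ₑ ≤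
      eLpNorm (fun y => gagliardoQuotient n s p u (x, y)) p volume *
        volume (Metric.ball x h) ^ (1 - (p⁻¹).toReal) := by
    have := eLpNorm_le_eLpNorm_mul_rpow_measure_univ hp
      (hm.aestronglyMeasurable (μ := volume.restrict (Metric.ball x h)))
    rw [eLpNorm_one_eq_lintegral_enorm, Measure.restrict_apply_univ] at this
    refine this.trans ?_
    rw [ENNReal.toReal_inv, ENNReal.toReal_one, div_one, one_div]
    gcongr
    exact Measure.restrict_le_self
  calc ∫⁻ y in Metric.ball x h, ‖u x - u y‖ₑ
      ≤ ∫⁻ y in Metric.ball x h, ‖gagliardoQuotient n s p u (x, y)‖ₑ *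
          ENNReal.ofReal (h ^ ((n : ℝ) * (p⁻¹).toReal + s)) := by
        refine setLIntegral_mono (by fun_prop) fun y hy => ?_
        rw [enorm_sub_eq_gagliardoQuotient s p]
        gcongr
        rw [← dist_eq_norm, dist_comm]
        exact (Metric.mem_ball.1 hy).le
    _ ≤ eLpNorm (fun y => gagliardoQuotient n s p u (x, y)) p volume *
          volume (Metric.ball x h) ^ (1 - (p⁻¹).toReal) *
          ENNReal.ofReal (h ^ ((n : ℝ) * (p⁻¹).toReal + s)) := by
        rw [lintegral_mul_const _ (by fun_prop)]
        gcongr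
    _ = _ := by
        have e : volume (Metric.ball x h) ^ (1 - (p⁻¹).toReal) *
            ENNReal.ofReal (h ^ ((n : ℝ) * (p⁻¹).toReal + s)) =
            ENNReal.ofReal (unitBallVolume n ^ (1 - (p⁻¹).toReal)) *
            ENNReal.ofReal (h ^ ((n : ℝ) + s)) := by
          rw [volume_ball_eq x hh, ENNReal.ofReal_rpow_of_pos (by positivity),
            Real.mul_rpow hω.le (by positivity), ENNReal.ofReal_mul (by positivity), mul_assoc,
            ← ENNReal.ofReal_mul (by positivity), ← Real.rpow_mul hh.le, ← Real.rpow_add hh]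
          congr 3
          ring
        rw [mul_assoc, e]
        ring

/-- A function whose Gagliardo seminorm is at most one has its oscillation over balls controlled by
a function in the unit ball of `L^p`. -/
theorem exists_oscillation_bound {n : ℕ} {s : ℝ} (hs : 0 < s) {p : ℝ≥0∞} (hp : 1 ≤ p)
    {u : EuclideanSpace ℝ (Fin n) → ℝ} (hu : Measurable u)
    (hup : eLpNorm (gagliardoQuotient n s p u) p volume ≤ 1) :
    ∃ g : EuclideanSpace ℝ (Fin n) → ℝ≥0∞, Measurable g ∧ eLpNorm g p volume ≤ 1 ∧
      ∀ᵐ x, ∀ h : ℝ, 0 < h → ∫⁻ y in Metric.ball x h, ‖u x - u y‖ₑ ≤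
        ENNReal.ofReal (unitBallVolume n ^ (1 - (p⁻¹).toReal)) * g x *
          ENNReal.ofReal (h ^ ((n : ℝ) + s)) := by
  have hm := measurable_gagliardoQuotient s p hu
  have hp0 : p ≠ 0 := (one_pos.trans_le hp).ne'
  rcases eq_or_ne p ∞ with rfl | hpt
  -- For `p = ∞`, Fubini bounds almost every slice by 1, so the constant serves and the
  -- measurability of slice suprema never arises.
  · refine ⟨fun _ => 1, measurable_const, ?_, ?_⟩
    · rw [eLpNorm_exponent_top]
      refine eLpNormEssSup_le_of_ae_enorm_bound (C := 1) (.of_forall fun x => ?_)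
      simp
    · have h1 : ∀ᵐ z ∂(volume : Measure (EuclideanSpace ℝ (Fin n) × EuclideanSpace ℝ (Fin n))),
          ‖gagliardoQuotient n s ∞ u z‖ₑ ≤ 1 := by
        rw [eLpNorm_exponent_top] at hup
        filter_upwards [ae_le_eLpNormEssSup (f := gagliardoQuotient n s ∞ u)] with z hz
        exact hz.trans hup
      filter_upwards [Measure.ae_ae_of_ae_prod h1] with x hx h hh
      refine (setLIntegral_ball_enorm_sub_le hs hp hu x hh).trans ?_
      gcongr
      rw [eLpNorm_exponent_top]
      exact eLpNormEssSup_le_of_ae_enorm_bound hx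
  -- For finite `p`, take the `L^p` norm of the slice at `x`; by Tonelli its own `L^p` norm is the
  -- full seminorm.
  · refine ⟨fun x => eLpNorm (fun y => gagliardoQuotient n s p u (x, y)) p volume, ?_, ?_,
      .of_forall fun x h hh => setLIntegral_ball_enorm_sub_le hs hp hu x hh⟩
    · simp_rw [eLpNorm_eq_lintegral_rpow_enorm_toReal hp0 hpt]
      exact (Measurable.lintegral_prod_right' (f := fun z =>
        ‖gagliardoQuotient n s p u z‖ₑ ^ p.toReal) (by fun_prop)).pow_const _
    · refine le_trans (le_of_eq ?_) hup
      have hp1 : p.toReal ≠ 0 := (ENNReal.toReal_pos hp0 hpt).ne'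
      simp_rw [eLpNorm_eq_lintegral_rpow_enorm_toReal hp0 hpt, enorm_eq_self, one_div,
        ENNReal.rpow_inv_rpow hp1]
      congr 1
      exact (lintegral_prod (μ := volume) (ν := volume) (fun z =>
        ‖gagliardoQuotient n s p u z‖ₑ ^ p.toReal) (by fun_prop)).symm

/-! ### Higher integrability -/

/-- Compare `u x` with `u` on a ball so large that the `L^m` bound forces the average of `|u|` below
`|u x|/2`. That half is absorbed, and the oscillation bound controls what remains. -/
theorem enorm_rpow_le_of_oscillation {n : ℕ} (hn : n ≠ 0) {s C m M : ℝ} (hC : 0 < C)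
    (hm : 1 ≤ m) (hM : 0 < M) {u : EuclideanSpace ℝ (Fin n) → ℝ} (hu : Measurable u)
    (huM : ∫⁻ x, ‖u x‖ₑ ^ m ≤ ENNReal.ofReal M) (x : EuclideanSpace ℝ (Fin n)) (γ : ℝ≥0∞)
    (hx : ∀ h : ℝ, 0 < h → ∫⁻ y in Metric.ball x h, ‖u x - u y‖ₑ ≤
      ENNReal.ofReal C * γ * ENNReal.ofReal (h ^ ((n : ℝ) + s))) (hs : 0 < s) :
    ‖u x‖ₑ ^ (1 + m * s / n) ≤ ENNReal.ofReal
      (2 * C / unitBallVolume n * (2 ^ m * M / unitBallVolume n) ^ (s / n)) * γ := by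
  set ω := unitBallVolume n with hω'
  have hω : 0 < ω := unitBallVolume_pos n
  have hn' : (0 : ℝ) < n := by positivity
  rcases eq_or_ne (u x) 0 with hux | hux
  · rw [hux, enorm_zero, ENNReal.zero_rpow_of_pos (by positivity)]
    exact zero_le
  rcases eq_or_ne γ ∞ with rfl | hγ
  · rw [ENNReal.mul_top]
    · exact le_top
    · exact (ENNReal.ofReal_pos.2 (by positivity)).ne'
  lift γ to NNReal using hγ
  set a := ‖u x‖ with ha'
  have ha : 0 < a := norm_pos_iff.2 hux
  have hae : ‖u x‖ₑ = ENNReal.ofReal a := (ofReal_norm _).symm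
  -- `W` is the volume of the ball and solves `(M / W)^(1/m) = a / 2`: Hölder then gives average at
  -- most `a / 2`.
  set W := 2 ^ m * M / a ^ m with hW'
  have hW : 0 < W := by positivity
  set h := (W / ω) ^ (1 / (n : ℝ)) with hh'
  have hh : 0 < h := by positivity
  have hhn : h ^ (n : ℝ) = W / ω := by
    rw [hh', ← Real.rpow_mul (by positivity), one_div_mul_cancel hn'.ne', Real.rpow_one]
  have hvol : volume (Metric.ball x h) = ENNReal.ofReal W := by
    rw [volume_ball_eq x hh, hhn]
    rw [← hω']
    congr 1
    field_simp
  have hMW : M ^ (1 / m) * W ^ (1 - 1 / m) = W * a / 2 := by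
    have h1 : W ^ (1 / m) = 2 * M ^ (1 / m) / a := by
      rw [hW', Real.div_rpow (by positivity) (by positivity), Real.mul_rpow (by positivity) hM.le,
        ← Real.rpow_mul (by positivity), ← Real.rpow_mul ha.le, mul_one_div_cancel (by positivity),
        Real.rpow_one, Real.rpow_one]
    rw [Real.rpow_sub hW, Real.rpow_one, h1]
    field_simp
  have hball : ∫⁻ y in Metric.ball x h, ‖u y‖ₑ ≤ ENNReal.ofReal (W * a / 2) := by
    have h1 := eLpNorm_le_eLpNorm_mul_rpow_measure_univ (p := 1) (q := ENNReal.ofReal m)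
      (by rw [← ENNReal.ofReal_one]; exact ENNReal.ofReal_le_ofReal hm)
      (hu.aestronglyMeasurable (μ := volume.restrict (Metric.ball x h)))
    rw [eLpNorm_one_eq_lintegral_enorm, Measure.restrict_apply_univ, hvol,
      eLpNorm_eq_lintegral_rpow_enorm_toReal (by simp; linarith) (by simp),
      ENNReal.toReal_ofReal (by linarith), ENNReal.toReal_one, div_one] at h1
    refine h1.trans ?_
    rw [← hMW, ENNReal.ofReal_mul (by positivity), ← ENNReal.ofReal_rpow_of_pos hM,
      ← ENNReal.ofReal_rpow_of_pos hW]
    gcongr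
    exact (setLIntegral_le_lintegral _ _).trans huM
  have key : ENNReal.ofReal (a * W) ≤
      ENNReal.ofReal C * γ * ENNReal.ofReal (h ^ ((n : ℝ) + s)) + ENNReal.ofReal (W * a / 2) := by
    calc ENNReal.ofReal (a * W) = ∫⁻ y in Metric.ball x h, ‖u x‖ₑ := by
          rw [lintegral_const, Measure.restrict_apply_univ, hvol, hae,
            ← ENNReal.ofReal_mul ha.le]
      _ ≤ ∫⁻ y in Metric.ball x h, (‖u x - u y‖ₑ + ‖u y‖ₑ) := by
          refine lintegral_mono fun y => ?_
          simpa using enorm_add_le (u x - u y) (u y)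
      _ = _ := lintegral_add_right _ (by fun_prop)
      _ ≤ _ := add_le_add (hx h hh) hball
  have hγ' : (γ : ℝ≥0∞) = ENNReal.ofReal γ := (ENNReal.ofReal_coe_nnreal).symm
  rw [hγ', ← ENNReal.ofReal_mul hC.le, ← ENNReal.ofReal_mul (by positivity),
    ← ENNReal.ofReal_add (by positivity) (by positivity),
    ENNReal.ofReal_le_ofReal_iff (by positivity), Real.rpow_add hh, hhn] at key
  -- The radius depends on `a` through `h^s ~ a^(-ms/n)`, which is the source of the extra exponent
  -- on the left of the conclusion.
  have hhs : h ^ s * a ^ (m * s / n) = (2 ^ m * M / ω) ^ (s / n) := by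
    have : W / ω = (2 ^ m * M / ω) / a ^ m := by rw [hW']; field_simp
    rw [hh', ← Real.rpow_mul (by positivity), this, Real.div_rpow (by positivity) (by positivity),
      ← Real.rpow_mul ha.le]
    rw [show 1 / (n : ℝ) * s = s / n by ring, show m * (s / (n : ℝ)) = m * s / n by ring]
    field_simp
  have key2 : a ≤ 2 * C / ω * γ * h ^ s := by
    have : a * W / 2 ≤ W * (C * γ * h ^ s / ω) := by
      have e : C * γ * (W / ω * h ^ s) = W * (C * γ * h ^ s / ω) := by field_simp
      linarith
    have := le_of_mul_le_mul_left (by linarith : W * (a / 2) ≤ W * (C * γ * h ^ s / ω)) hW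
    calc a ≤ 2 * (C * γ * h ^ s / ω) := by linarith
      _ = _ := by ring
  rw [hae, ENNReal.ofReal_rpow_of_pos ha, hγ', ← ENNReal.ofReal_mul (by positivity)]
  refine ENNReal.ofReal_le_ofReal ?_
  rw [Real.rpow_add ha, Real.rpow_one, ← hhs]
  calc a * a ^ (m * s / n) ≤ 2 * C / ω * γ * h ^ s * a ^ (m * s / n) := by gcongr
    _ = _ := by ring

theorem ENNReal.rpow_le_rpow_add_rpow (a : ℝ≥0∞) {q m k : ℝ} (hqm : q ≤ m) (hmk : m ≤ k) :
    a ^ m ≤ a ^ q + a ^ k := by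
  rcases le_total a 1 with ha | ha
  · exact (ENNReal.rpow_le_rpow_of_exponent_ge ha hqm).trans le_self_add
  · exact (ENNReal.rpow_le_rpow_of_exponent_le ha hmk).trans le_add_self

/-- One step of the iteration which improves the integrability of a function with finite Gagliardo
seminorm. -/
theorem exists_lintegral_rpow_le_step {n : ℕ} (hn : n ≠ 0) {s : ℝ} (hs : 0 < s) {p : ℝ≥0∞}
    (hp : 1 ≤ p) (hpt : p ≠ ∞) {m M : ℝ} (hm : 1 ≤ m) (hM : 0 < M) :
    ∃ M' : ℝ, 0 < M' ∧ ∀ u : EuclideanSpace ℝ (Fin n) → ℝ, Measurable u →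
      eLpNorm (gagliardoQuotient n s p u) p volume ≤ 1 →
      ∫⁻ x, ‖u x‖ₑ ^ m ≤ ENNReal.ofReal M →
      ∫⁻ x, ‖u x‖ₑ ^ (p.toReal * (1 + m * s / n)) ≤ ENNReal.ofReal M' := by
  have hω := unitBallVolume_pos n
  have hp0 : p ≠ 0 := (one_pos.trans_le hp).ne'
  have hp1 : 0 < p.toReal := ENNReal.toReal_pos hp0 hpt
  set C₁ := 2 * (unitBallVolume n ^ (1 - (p⁻¹).toReal)) / unitBallVolume n *
    (2 ^ m * M / unitBallVolume n) ^ (s / n) with hC₁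
  have hC₁0 : 0 < C₁ := by positivity
  refine ⟨C₁ ^ p.toReal, by positivity, fun u hu hup huM => ?_⟩
  obtain ⟨g, hg, hgp, hug⟩ := exists_oscillation_bound hs hp hu hup
  rw [eLpNorm_eq_lintegral_rpow_enorm_toReal hp0 hpt, one_div,
    ENNReal.rpow_inv_le_iff hp1, ENNReal.one_rpow] at hgp
  calc ∫⁻ x, ‖u x‖ₑ ^ (p.toReal * (1 + m * s / n))
      ≤ ∫⁻ x, ENNReal.ofReal (C₁ ^ p.toReal) * g x ^ p.toReal := by
        refine lintegral_mono_ae ?_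
        filter_upwards [hug] with x hx
        have := enorm_rpow_le_of_oscillation hn (by positivity) hm hM hu huM x (g x) hx hs
        rw [mul_comm, ENNReal.rpow_mul, ← ENNReal.ofReal_rpow_of_pos hC₁0,
          ← ENNReal.mul_rpow_of_nonneg _ _ hp1.le]
        gcongr
    _ = ENNReal.ofReal (C₁ ^ p.toReal) * ∫⁻ x, g x ^ p.toReal :=
        lintegral_const_mul _ (by fun_prop)
    _ ≤ ENNReal.ofReal (C₁ ^ p.toReal) * 1 := by
        gcongr
        simpa using hgp
    _ = _ := mul_one _

/-- Here `g ≤ 1` almost everywhere, so a single use of the pointwise estimate bounds `u` in `L^∞`;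
then `|u|^m ≤ ‖u‖_∞^(m-q) |u|^q`. -/
theorem exists_lintegral_rpow_le_of_top {n : ℕ} (hn : n ≠ 0) {s : ℝ} (hs : 0 < s)
    {q A : ℝ} (hq : 1 ≤ q) (hA : 0 < A) {m : ℝ} (hqm : q ≤ m) :
    ∃ M : ℝ, 0 < M ∧ ∀ u : EuclideanSpace ℝ (Fin n) → ℝ, Measurable u →
      eLpNorm (gagliardoQuotient n s ∞ u) ∞ volume ≤ 1 →
      ∫⁻ x, ‖u x‖ₑ ^ q ≤ ENNReal.ofReal A → ∫⁻ x, ‖u x‖ₑ ^ m ≤ ENNReal.ofReal M := by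
  have hω := unitBallVolume_pos n
  set C₁ := 2 * (unitBallVolume n ^ (1 - ((∞ : ℝ≥0∞)⁻¹).toReal)) / unitBallVolume n *
    (2 ^ q * A / unitBallVolume n) ^ (s / n) with hC₁
  have hC₁0 : 0 < C₁ := by positivity
  set θ := 1 + q * s / n
  have hθ : 0 < θ := by positivity
  refine ⟨(C₁ ^ θ⁻¹) ^ (m - q) * A, by positivity, fun u hu hup huA => ?_⟩
  obtain ⟨g, hg, hgp, hug⟩ := exists_oscillation_bound hs le_top hu hup
  rw [eLpNorm_exponent_top] at hgp
  calc ∫⁻ x, ‖u x‖ₑ ^ m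
      ≤ ∫⁻ x, ENNReal.ofReal ((C₁ ^ θ⁻¹) ^ (m - q)) * ‖u x‖ₑ ^ q := by
        refine lintegral_mono_ae ?_
        filter_upwards [hug, ae_le_eLpNormEssSup (f := g) (μ := volume)] with x hx hgx
        have h1 := enorm_rpow_le_of_oscillation hn (by positivity) hq hA hu huA x (g x) hx hs
        have h2 : ‖u x‖ₑ ≤ ENNReal.ofReal (C₁ ^ θ⁻¹) := by
          rw [← ENNReal.ofReal_rpow_of_pos hC₁0, ENNReal.le_rpow_inv_iff hθ]
          refine h1.trans ?_
          calc _ ≤ ENNReal.ofReal C₁ * 1 := by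
                gcongr
                exact hgx.trans hgp
            _ = _ := mul_one _
        rw [← sub_add_cancel m q, ENNReal.rpow_add_of_nonneg _ _ (by linarith) (by linarith),
          sub_add_cancel, ← ENNReal.ofReal_rpow_of_pos (by positivity)]
        gcongr
    _ = ENNReal.ofReal ((C₁ ^ θ⁻¹) ^ (m - q)) * ∫⁻ x, ‖u x‖ₑ ^ q :=
        lintegral_const_mul _ (by fun_prop)
    _ ≤ _ := by
        rw [ENNReal.ofReal_mul (by positivity)]
        gcongr

/-- The embedding of the unit ball into `L^m` for all finite `m ≥ q`, in the range `n ≤ s p`. -/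
theorem exists_lintegral_rpow_le {n : ℕ} (hn : n ≠ 0) {s : ℝ} (hs : 0 < s) {p : ℝ≥0∞}
    (hp : 1 ≤ p) (hsp : (n : ℝ≥0∞) ≤ ENNReal.ofReal s * p) {q A : ℝ} (hq : 1 ≤ q) (hA : 0 < A)
    {m : ℝ} (hqm : q ≤ m) :
    ∃ M : ℝ, 0 < M ∧ ∀ u : EuclideanSpace ℝ (Fin n) → ℝ, Measurable u →
      eLpNorm (gagliardoQuotient n s p u) p volume ≤ 1 →
      ∫⁻ x, ‖u x‖ₑ ^ q ≤ ENNReal.ofReal A → ∫⁻ x, ‖u x‖ₑ ^ m ≤ ENNReal.ofReal M := by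
  rcases eq_or_ne p ∞ with rfl | hpt
  · exact exists_lintegral_rpow_le_of_top hn hs hq hA hqm
  have hp1 : 1 ≤ p.toReal := by
    rw [← ENNReal.toReal_one]
    exact ENNReal.toReal_mono hpt hp
  have hsp' : (n : ℝ) ≤ s * p.toReal := by
    have := ENNReal.toReal_mono (ENNReal.mul_ne_top ENNReal.ofReal_ne_top hpt) hsp
    rwa [ENNReal.toReal_natCast, ENNReal.toReal_mul, ENNReal.toReal_ofReal hs.le] at this
  have hn' : (0 : ℝ) < n := by positivity
  -- Each step gains at least one: `p (1 + l s / n) ≥ p + l ≥ l + 1`, the first inequality being `sp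
  -- ≥ n`.
  have iter : ∀ k : ℕ, ∃ l : ℝ, q + k ≤ l ∧ ∃ M : ℝ, 0 < M ∧
      ∀ u : EuclideanSpace ℝ (Fin n) → ℝ, Measurable u →
      eLpNorm (gagliardoQuotient n s p u) p volume ≤ 1 →
      ∫⁻ x, ‖u x‖ₑ ^ q ≤ ENNReal.ofReal A → ∫⁻ x, ‖u x‖ₑ ^ l ≤ ENNReal.ofReal M := by
    intro k
    induction k with
    | zero => exact ⟨q, by simp, A, hA, fun u _ _ h => h⟩
    | succ k ih =>
      obtain ⟨l, hl, M, hM, H⟩ := ih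
      have hk : (0 : ℝ) ≤ k := by positivity
      obtain ⟨M', hM', H'⟩ := exists_lintegral_rpow_le_step hn hs hp hpt (by linarith : 1 ≤ l) hM
      refine ⟨_, ?_, M', hM', fun u hu hup huA => H' u hu hup (H u hu hup huA)⟩
      have : l ≤ p.toReal * (l * s / n) := by
        have e : p.toReal * (l * s / n) = l * (s * p.toReal / n) := by ring
        rw [e]
        exact le_mul_of_one_le_right (by linarith) ((one_le_div hn').2 hsp')
      push_cast
      rw [mul_add, mul_one]
      linarith
  obtain ⟨k, hk⟩ := exists_nat_ge m
  obtain ⟨l, hl, M, hM, H⟩ := iter k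
  refine ⟨A + M, by positivity, fun u hu hup huA => ?_⟩
  calc ∫⁻ x, ‖u x‖ₑ ^ m ≤ ∫⁻ x, (‖u x‖ₑ ^ q + ‖u x‖ₑ ^ l) :=
        lintegral_mono fun x => ENNReal.rpow_le_rpow_add_rpow _ hqm (by linarith)
    _ = _ := lintegral_add_left (by fun_prop) _
    _ ≤ _ := by
        rw [ENNReal.ofReal_add hA.le hM.le]
        exact add_le_add huA (H u hu hup huA)

/-! ### Weighted estimates: tails and Hölder -/

/-- Interpolation between `a ^ q * v` and a power of `a`. -/
theorem ENNReal.exists_rpow_mul_rpow_le {q r τ : ℝ} (hq : 0 < q)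
    (hτ : (q < r ∧ 0 < τ ∧ τ < 1) ∨ (q = r ∧ τ = 1)) :
    ∃ m : ℝ, q ≤ m ∧ ∀ a v : ℝ≥0∞, a ^ r * v ^ τ ≤ a ^ q * v + a ^ m := by
  rcases hτ with ⟨hqr, hτ0, hτ1⟩ | ⟨rfl, rfl⟩
  · have h1 : 0 < 1 - τ := by linarith
    -- `m` is the solution of `r = q τ + m (1 - τ)`.
    refine ⟨(r - q * τ) / (1 - τ), ?_, fun a v => ?_⟩
    · rw [le_div_iff₀ h1]
      linarith
    have hm : 0 ≤ (r - q * τ) / (1 - τ) :=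
      div_nonneg (by nlinarith) h1.le
    set m := (r - q * τ) / (1 - τ) with hm'
    have hr : r = q * τ + m * (1 - τ) := by
      rw [hm', div_mul_cancel₀ _ h1.ne']
      ring
    calc a ^ r * v ^ τ = (a ^ q * v) ^ τ * (a ^ m) ^ (1 - τ) := by
          rw [ENNReal.mul_rpow_of_nonneg _ _ hτ0.le, ← ENNReal.rpow_mul, ← ENNReal.rpow_mul]
          conv_lhs => rw [hr, ENNReal.rpow_add_of_nonneg _ _ (by positivity) (by positivity)]
          ring
      -- Young's inequality is not needed: each factor is bounded by the sum, and the exponents add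
      -- up to 1.
      _ ≤ (a ^ q * v + a ^ m) ^ τ * (a ^ q * v + a ^ m) ^ (1 - τ) := by
          gcongr
          · exact le_self_add
          · exact le_add_self
      _ = a ^ q * v + a ^ m := by
          rw [← ENNReal.rpow_add_of_nonneg _ _ hτ0.le h1.le, add_sub_cancel, ENNReal.rpow_one]
  · exact ⟨q, le_rfl, fun a v => by simp⟩

/-- Outside the superlevel set, `K < c V^τ`, which turns the interpolation inequality into smallness
of the tail. -/
theorem setLIntegral_compl_rpow_mul_le {n : ℕ} {K V : EuclideanSpace ℝ (Fin n) → ℝ} {q r τ m c : ℝ}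
    (hV : ∀ x, 0 < V x) (hm : ∀ a v : ℝ≥0∞, a ^ r * v ^ τ ≤ a ^ q * v + a ^ m) (hc : 0 < c)
    {Ω : Set (EuclideanSpace ℝ (Fin n))} (hΩm : MeasurableSet Ω)
    (hΩ : {x | c ≤ |K x * V x ^ (-τ)|} ⊆ Ω)
    {u : EuclideanSpace ℝ (Fin n) → ℝ} (hu : Measurable u) :
    ∫⁻ x in Ωᶜ, ‖u x‖ₑ ^ r * ENNReal.ofReal (K x) ≤
      ENNReal.ofReal c *
        ((∫⁻ x, ‖u x‖ₑ ^ q * ENNReal.ofReal (V x)) + ∫⁻ x, ‖u x‖ₑ ^ m) := by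
  rw [← lintegral_add_right _ (by fun_prop), ← lintegral_const_mul' _ _ ENNReal.ofReal_ne_top]
  refine (setLIntegral_mono' hΩm.compl fun x hx => ?_).trans (setLIntegral_le_lintegral _ _)
  have hx1 : K x ≤ c * V x ^ τ := by
    have h1 : |K x * V x ^ (-τ)| < c := not_le.1 fun h => hx (hΩ h)
    have h2 : K x * V x ^ (-τ) < c := (le_abs_self _).trans_lt h1
    rw [Real.rpow_neg (hV x).le, ← div_eq_mul_inv, div_lt_iff₀ (Real.rpow_pos_of_pos (hV x) _)] at h2
    exact h2.le
  calc ‖u x‖ₑ ^ r * ENNReal.ofReal (K x)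
      ≤ ‖u x‖ₑ ^ r * ENNReal.ofReal (c * V x ^ τ) := by gcongr
    _ = ENNReal.ofReal c * (‖u x‖ₑ ^ r * ENNReal.ofReal (V x) ^ τ) := by
        rw [ENNReal.ofReal_mul hc.le, ENNReal.ofReal_rpow_of_pos (hV x)]
        ring
    _ ≤ _ := by
        gcongr
        exact hm _ _

theorem setLIntegral_rpow_mul_le_holder {α : Type*} [MeasurableSpace α] {μ : Measure α}
    {r t t' : ℝ} (ht : t'.HolderConjugate t) {f K : α → ℝ≥0∞} (hf : AEMeasurable f μ)
    (hK : AEMeasurable K μ) (T : Set α) :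
    ∫⁻ x in T, f x ^ r * K x ∂μ ≤
      (∫⁻ x in T, f x ^ (r * t') ∂μ) ^ (1 / t') * (∫⁻ x in T, K x ^ t ∂μ) ^ (1 / t) := by
  have := ENNReal.lintegral_mul_le_Lp_mul_Lq (μ.restrict T) ht
    (hf.restrict.pow_const r) hK.restrict
  simpa only [Pi.mul_apply, ← ENNReal.rpow_mul] using this

theorem ENNReal.exists_ofReal_rpow_mul_le {α : ℝ} (hα : 0 < α) {D ε : ℝ≥0∞} (hD : D ≠ ∞)
    (hε : 0 < ε) : ∃ δ : ℝ, 0 < δ ∧ ENNReal.ofReal δ ^ α * D ≤ ε := by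
  have h1 : Filter.Tendsto (fun δ : ℝ => ENNReal.ofReal δ ^ α * D) (nhdsWithin 0 (Set.Ioi 0))
      (nhds 0) := by
    have h2 : Filter.Tendsto (fun δ : ℝ => ENNReal.ofReal δ ^ α * D) (nhds 0)
        (nhds (ENNReal.ofReal 0 ^ α * D)) :=
      ENNReal.Tendsto.mul_const ((ENNReal.continuous_rpow_const.comp
        ENNReal.continuous_ofReal).tendsto 0) (.inr hD)
    rw [ENNReal.ofReal_zero, ENNReal.zero_rpow_of_pos hα, zero_mul] at h2
    exact h2.mono_left nhdsWithin_le_nhds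
  obtain ⟨δ, h, hδ⟩ := ((h1.eventually (eventually_le_nhds hε)).and self_mem_nhdsWithin).exists
  exact ⟨δ, hδ, h⟩

/-! ### Coverings, averages and truncation -/

/-- A set of finite measure is exhausted, up to a small integral, by finitely many balls with
centres in a dense sequence. -/
theorem exists_setLIntegral_diff_iUnion_ball_le {α : Type*} [MeasurableSpace α]
    [PseudoMetricSpace α] [OpensMeasurableSpace α] {μ : Measure α} {e : ℕ → α} (he : DenseRange e)
    {Ω : Set α} (hμ : μ Ω < ∞) {f : α → ℝ≥0∞} (hf : ∫⁻ x in Ω, f x ∂μ ≠ ∞)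
    {h : ℝ} (hh : 0 < h) {ε : ℝ≥0∞} (hε : 0 < ε) :
    ∃ N : ℕ, ∫⁻ x in Ω \ ⋃ k ≤ N, Metric.ball (e k) h, f x ∂μ ≤ ε := by
  have : IsFiniteMeasure (μ.restrict Ω) := ⟨by simpa using hμ⟩
  have hm : ∀ N : ℕ, MeasurableSet (⋃ k ≤ N, Metric.ball (e k) h)ᶜ := fun N =>
    (MeasurableSet.iUnion fun k => .iUnion fun _ => Metric.isOpen_ball.measurableSet).compl
  have h1 : Filter.Tendsto ((μ.restrict Ω) ∘ fun N : ℕ => (⋃ k ≤ N, Metric.ball (e k) h)ᶜ)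
      Filter.atTop (nhds 0) := by
    have := tendsto_measure_iInter_atTop (μ := μ.restrict Ω)
      (s := fun N : ℕ => (⋃ k ≤ N, Metric.ball (e k) h)ᶜ)
      (fun N => (hm N).nullMeasurableSet)
      (fun N N' hN => Set.compl_subset_compl.2 <|
        Set.biUnion_subset_biUnion_left fun k (hk : k ≤ N) => hk.trans hN)
      ⟨0, measure_ne_top _ _⟩
    have e0 : ⋂ N : ℕ, (⋃ k ≤ N, Metric.ball (e k) h)ᶜ = ∅ := by
      refine Set.eq_empty_of_forall_notMem fun x hx => ?_
      obtain ⟨k, hk⟩ := he.exists_dist_lt x hh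
      refine Set.mem_iInter.1 hx k ?_
      simp only [Set.mem_iUnion]
      exact ⟨k, le_rfl, hk⟩
    rwa [e0, measure_empty] at this
  have h2 := tendsto_setLIntegral_zero hf h1
  obtain ⟨N, hN⟩ := (h2.eventually (eventually_le_nhds hε)).exists
  refine ⟨N, ?_⟩
  rwa [Measure.restrict_restrict (hm N), Set.inter_comm, ← Set.sdiff_eq] at hN

theorem enorm_sub_setAverage_le {α : Type*} [MeasurableSpace α] {μ : Measure α} {B : Set α}
    (hB0 : μ B ≠ 0) (hB : μ B ≠ ∞) {u : α → ℝ} (hu : IntegrableOn u B μ) (a : ℝ) :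
    ‖a - ⨍ y in B, u y ∂μ‖ₑ ≤ (μ B)⁻¹ * ∫⁻ y in B, ‖a - u y‖ₑ ∂μ := by
  have : IsFiniteMeasure (μ.restrict B) := ⟨by simpa using hB.lt_top⟩
  have : NeZero (μ.restrict B) := ⟨by simpa using hB0⟩
  have h1 : a - ⨍ y in B, u y ∂μ = ⨍ y in B, (a - u y) ∂μ := by
    have hi : Integrable u (((μ.restrict B) Set.univ)⁻¹ • μ.restrict B) :=
      Integrable.smul_measure hu (by simpa using hB0)
    rw [average, average, integral_sub (integrable_const _) hi]
    congr 1
    exact (average_const (μ.restrict B) a).symm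
  rw [h1, average]
  refine (enorm_integral_le_lintegral_enorm _).trans_eq ?_
  rw [lintegral_smul_measure, Measure.restrict_apply_univ, smul_eq_mul]

/-- Truncation of a real number at height `Λ`. -/
def truncate (Λ a : ℝ) : ℝ := max (-Λ) (min Λ a)

theorem abs_truncate_sub_truncate_le (Λ a b : ℝ) : |truncate Λ a - truncate Λ b| ≤ |a - b| := by
  unfold truncate
  refine (abs_max_sub_max_le_max _ _ _ _).trans (max_le (by simp) ?_)
  exact (abs_min_sub_min_le_max Λ a Λ b).trans (by simp)

theorem abs_truncate_le {Λ : ℝ} (hΛ : 0 ≤ Λ) (a : ℝ) : |truncate Λ a| ≤ Λ := by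
  unfold truncate
  rw [abs_le]
  exact ⟨le_max_left _ _, max_le (by linarith) (min_le_left _ _)⟩

theorem truncate_of_abs_le {Λ a : ℝ} (h : |a| ≤ Λ) : truncate Λ a = a := by
  rw [abs_le] at h
  rw [truncate, min_eq_right h.2, max_eq_right h.1]

theorem measurable_truncate (Λ : ℝ) : Measurable (truncate Λ) := by
  unfold truncate
  fun_prop

/-- The error vanishes unless `|a| > Λ`, where one extra power of `|a|` pays for the factor `Λ⁻¹`.
-/
theorem enorm_sub_truncate_rpow_le {Λ k : ℝ} (hΛ : 0 < Λ) (hk : 0 < k) (a : ℝ) :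
    ‖a - truncate Λ a‖ₑ ^ k ≤ ENNReal.ofReal Λ⁻¹ * ‖a‖ₑ ^ (k + 1) := by
  rcases le_or_gt |a| Λ with h | h
  · rw [truncate_of_abs_le h, sub_self, enorm_zero, ENNReal.zero_rpow_of_pos hk]
    exact zero_le
  · have h1 : |a - truncate Λ a| ≤ |a| := by
      unfold truncate
      rcases le_total 0 a with ha | ha
      · rw [abs_of_nonneg ha] at h ⊢
        rw [min_eq_left h.le, max_eq_right (by linarith), abs_of_nonneg (by linarith)]
        linarith
      · rw [abs_of_nonpos ha] at h ⊢
        rw [min_eq_right (by linarith), max_eq_left (by linarith), abs_of_nonpos (by linarith)]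
        linarith
    rw [← ofReal_norm, ← ofReal_norm, Real.norm_eq_abs, Real.norm_eq_abs,
      ENNReal.ofReal_rpow_of_nonneg (abs_nonneg _) hk.le,
      ENNReal.ofReal_rpow_of_nonneg (abs_nonneg _) (by linarith),
      ← ENNReal.ofReal_mul (by positivity)]
    refine ENNReal.ofReal_le_ofReal ?_
    have ha : 0 < |a| := hΛ.trans h
    calc |a - truncate Λ a| ^ k ≤ |a| ^ k := by gcongr
      _ = Λ⁻¹ * (|a| ^ k * Λ) := by field_simp
      _ ≤ Λ⁻¹ * (|a| ^ k * |a|) := by gcongr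
      _ = _ := by rw [Real.rpow_add ha, Real.rpow_one]

/-- Since `B(z,h) ⊆ B(x,2h)`, the oscillation bound centred at `x` controls averages about nearby
centres too, so finitely many centres suffice later. -/
theorem enorm_sub_average_ball_le {n : ℕ} {s C : ℝ} (hC : 0 < C)
    {u : EuclideanSpace ℝ (Fin n) → ℝ} (hu : Continuous u)
    {x z : EuclideanSpace ℝ (Fin n)} {γ : ℝ≥0∞}
    (hx : ∀ h : ℝ, 0 < h → ∫⁻ y in Metric.ball x h, ‖u x - u y‖ₑ ≤
      ENNReal.ofReal C * γ * ENNReal.ofReal (h ^ ((n : ℝ) + s)))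
    {h : ℝ} (hh : 0 < h) (hxz : x ∈ Metric.ball z h) :
    ‖u x - ⨍ y in Metric.ball z h, u y‖ₑ ≤
      ENNReal.ofReal (C * 2 ^ ((n : ℝ) + s) / unitBallVolume n) * γ * ENNReal.ofReal (h ^ s) := by
  have hω := unitBallVolume_pos n
  have hv : 0 < unitBallVolume n * h ^ (n : ℝ) := by positivity
  have hi : IntegrableOn u (Metric.ball z h) volume :=
    (hu.continuousOn.integrableOn_compact (isCompact_closedBall z h)).mono_set
      Metric.ball_subset_closedBall
  refine (enorm_sub_setAverage_le (Metric.measure_ball_pos _ _ hh).ne' measure_ball_lt_top.ne hi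
    (u x)).trans ?_
  have hsub : Metric.ball z h ⊆ Metric.ball x (2 * h) := by
    intro y hy
    rw [Metric.mem_ball] at *
    linarith [dist_triangle_right y x z]
  calc (volume (Metric.ball z h))⁻¹ * ∫⁻ y in Metric.ball z h, ‖u x - u y‖ₑ
      ≤ (volume (Metric.ball z h))⁻¹ *
          (ENNReal.ofReal C * γ * ENNReal.ofReal ((2 * h) ^ ((n : ℝ) + s))) := by
        gcongr
        exact (lintegral_mono_set hsub).trans (hx _ (by positivity))
    _ = ENNReal.ofReal ((unitBallVolume n * h ^ (n : ℝ))⁻¹ * C * (2 * h) ^ ((n : ℝ) + s)) * γ := by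
        rw [volume_ball_eq z hh, ← ENNReal.ofReal_inv_of_pos hv, ENNReal.ofReal_mul (by positivity),
          ENNReal.ofReal_mul (by positivity)]
        ring
    _ = _ := by
        rw [mul_right_comm (ENNReal.ofReal _), ← ENNReal.ofReal_mul (by positivity)]
        congr 2
        rw [Real.mul_rpow (by positivity) hh.le, Real.rpow_add hh]
        field_simp

/-- The properties of the test functions in the unit ball on which the compactness relies. -/
structure IsUnitTestFunction {n : ℕ} (s : ℝ) (p : ℝ≥0∞) (q A : ℝ)
    (V u : EuclideanSpace ℝ (Fin n) → ℝ) : Prop where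
  continuous : Continuous u
  gagliardo_le : eLpNorm (gagliardoQuotient n s p u) p volume ≤ 1
  lintegral_weight_le : ∫⁻ x, ‖u x‖ₑ ^ q * ENNReal.ofReal (V x) ≤ 1
  lintegral_le : ∫⁻ x, ‖u x‖ₑ ^ q ≤ ENNReal.ofReal A

theorem setLIntegral_le_rpow_of_eLpNorm_le_one {α : Type*} [MeasurableSpace α] {μ : Measure α}
    {p : ℝ≥0∞} (hp : 1 ≤ p) {g : α → ℝ≥0∞} (hg : Measurable g) (hgp : eLpNorm g p μ ≤ 1)
    (Ω : Set α) : ∫⁻ x in Ω, g x ∂μ ≤ μ Ω ^ (1 - (p⁻¹).toReal) := by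
  have h := eLpNorm_le_eLpNorm_mul_rpow_measure_univ hp
    (hg.aestronglyMeasurable (μ := μ.restrict Ω))
  rw [eLpNorm_one_eq_lintegral_enorm, Measure.restrict_apply_univ] at h
  calc ∫⁻ x in Ω, g x ∂μ ≤ 1 * μ Ω ^ (1 / (1 : ℝ≥0∞).toReal - 1 / p.toReal) := by
        refine h.trans ?_
        gcongr
        exact (eLpNorm_mono_measure g Measure.restrict_le_self).trans hgp
    _ = _ := by rw [one_mul, ENNReal.toReal_inv, ENNReal.toReal_one, div_one, one_div]

/-- The oscillation of a truncated function about its truncated local averages is small in every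
`L^k`. -/
theorem setLIntegral_truncate_sub_rpow_le {n : ℕ} {s : ℝ} (hs : 0 < s) {p : ℝ≥0∞} (hp : 1 ≤ p)
    {u : EuclideanSpace ℝ (Fin n) → ℝ} (hu : Continuous u)
    (hup : eLpNorm (gagliardoQuotient n s p u) p volume ≤ 1)
    {Λ k h : ℝ} (hΛ : 0 ≤ Λ) (hk : 1 ≤ k) (hh : 0 < h)
    {S Ω : Set (EuclideanSpace ℝ (Fin n))} (hSΩ : S ⊆ Ω)
    {z : EuclideanSpace ℝ (Fin n) → EuclideanSpace ℝ (Fin n)}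
    (hz : ∀ x ∈ S, x ∈ Metric.ball (z x) h) :
    ∫⁻ x in S, ‖truncate Λ (u x) - truncate Λ (⨍ y in Metric.ball (z x) h, u y)‖ₑ ^ k ≤
      ENNReal.ofReal (h ^ s) * (ENNReal.ofReal (2 * Λ) ^ (k - 1) *
        ENNReal.ofReal (unitBallVolume n ^ (1 - (p⁻¹).toReal) * 2 ^ ((n : ℝ) + s) /
          unitBallVolume n) * volume Ω ^ (1 - (p⁻¹).toReal)) := by
  have hω := unitBallVolume_pos n
  obtain ⟨g, hg, hgp, hug⟩ := exists_oscillation_bound hs hp hu.measurable hup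
  set C' := unitBallVolume n ^ (1 - (p⁻¹).toReal) * 2 ^ ((n : ℝ) + s) / unitBallVolume n
  calc ∫⁻ x in S, ‖truncate Λ (u x) - truncate Λ (⨍ y in Metric.ball (z x) h, u y)‖ₑ ^ k
      ≤ ∫⁻ x in S, ENNReal.ofReal (2 * Λ) ^ (k - 1) *
          (ENNReal.ofReal C' * g x * ENNReal.ofReal (h ^ s)) := by
        refine setLIntegral_mono_ae (by fun_prop) ?_
        filter_upwards [hug] with x hx hxS
        have h1 := enorm_sub_average_ball_le (by positivity) hu hx hh (hz x hxS)
        have h2 : ‖truncate Λ (u x) - truncate Λ (⨍ y in Metric.ball (z x) h, u y)‖ₑ ≤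
            ‖u x - ⨍ y in Metric.ball (z x) h, u y‖ₑ := by
          rw [enorm_le_iff_norm_le]
          exact abs_truncate_sub_truncate_le _ _ _
        have h3 : ‖truncate Λ (u x) - truncate Λ (⨍ y in Metric.ball (z x) h, u y)‖ₑ ≤
            ENNReal.ofReal (2 * Λ) := by
          rw [← ofReal_norm]
          refine ENNReal.ofReal_le_ofReal ((norm_sub_le _ _).trans ?_)
          rw [two_mul]
          exact add_le_add (abs_truncate_le hΛ _) (abs_truncate_le hΛ _)
        -- Truncation bounds `k - 1` of the factors by `2Λ`; only one factor uses the oscillation,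
        -- so local integrability of `g` is enough.
        rw [← sub_add_cancel k 1, ENNReal.rpow_add_of_nonneg _ _ (by linarith) zero_le_one,
          sub_add_cancel, ENNReal.rpow_one]
        gcongr
        exact h2.trans h1
    _ = ENNReal.ofReal (2 * Λ) ^ (k - 1) *
          (ENNReal.ofReal C' * (∫⁻ x in S, g x) * ENNReal.ofReal (h ^ s)) := by
        rw [lintegral_const_mul _ (by fun_prop), lintegral_mul_const _ (by fun_prop),
          lintegral_const_mul _ hg]
    _ ≤ ENNReal.ofReal (2 * Λ) ^ (k - 1) *
          (ENNReal.ofReal C' * volume Ω ^ (1 - (p⁻¹).toReal) * ENNReal.ofReal (h ^ s)) := by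
        gcongr
        exact (lintegral_mono_set hSΩ).trans (setLIntegral_le_rpow_of_eLpNorm_le_one hp hg hgp Ω)
    _ = _ := by ring

theorem sub_toReal_inv_nonneg {p : ℝ≥0∞} (hp : 1 ≤ p) : 0 ≤ 1 - (p⁻¹).toReal := by
  have : (p⁻¹).toReal ≤ (1 : ℝ≥0∞).toReal :=
    ENNReal.toReal_mono ENNReal.one_ne_top (ENNReal.inv_le_one.2 hp)
  rw [ENNReal.toReal_one] at this
  linarith

/-! ### Uniform approximation by step functions -/

/-- The functions in the unit ball are uniformly close, in `L^r(K)`, to linear combinations with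
bounded coefficients of finitely many fixed indicator functions. -/
theorem exists_uniform_simple_approximation {n : ℕ} (hn : n ≠ 0) {s : ℝ} (hs : 0 < s) {p : ℝ≥0∞}
    (hp : 1 ≤ p) (hsp : (n : ℝ≥0∞) ≤ ENNReal.ofReal s * p) {q r t A τ : ℝ} (hq : 1 ≤ q)
    (hqr : q ≤ r) (ht : 1 < t) (hA : 0 < A)
    {K V : EuclideanSpace ℝ (Fin n) → ℝ} (hKm : AEMeasurable K volume) (hV : ∀ x, 0 < V x)
    (hKt : ∀ Ω : Set (EuclideanSpace ℝ (Fin n)), MeasurableSet Ω → volume Ω < ∞ →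
      ∫⁻ x in Ω, ENNReal.ofReal (K x) ^ t < ∞)
    (hτ : (q < r ∧ 0 < τ ∧ τ < 1) ∨ (q = r ∧ τ = 1))
    (hKV : ∀ c : ℝ, 0 < c → volume {x | c ≤ |K x * V x ^ (-τ)|} < ∞) {ε : ℝ≥0∞} (hε : 0 < ε) :
    ∃ (N : ℕ) (Q : ℕ → Set (EuclideanSpace ℝ (Fin n))) (Λ : ℝ), (∀ k, MeasurableSet (Q k)) ∧
      (∀ k, volume (Q k) < ∞) ∧ ∀ u, IsUnitTestFunction s p q A V u → ∃ a : ℕ → ℝ,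
        (∀ k, |a k| ≤ Λ) ∧
        ∫⁻ x, ‖u x - ∑ k ∈ Finset.range (N + 1), (Q k).indicator (fun _ => a k) x‖ₑ ^ r *
          ENNReal.ofReal (K x) ≤ ε := by
  have hω := unitBallVolume_pos n
  have hr : 1 ≤ r := hq.trans hqr
  have hr0 : 0 < r := by linarith
  set t' := t.conjExponent with ht'
  have htt : t'.HolderConjugate t := (Real.HolderConjugate.conjExponent ht).symm
  have ht0 : 0 < t' := htt.pos
  have ht1 : 1 ≤ t' := htt.lt.le
  set k := r * t' with hk
  have hk1 : r ≤ k := le_mul_of_one_le_right hr0.le ht1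
  obtain ⟨m, hqm, hm⟩ := ENNReal.exists_rpow_mul_rpow_le (by linarith : 0 < q) hτ
  -- The exponent `m` serves the tail outside `Ω`, `k = r t'` the part of `Ω` missed by the balls,
  -- and `k + 1` the truncation error.
  obtain ⟨M₀, hM₀, HM₀⟩ := exists_lintegral_rpow_le hn hs hp hsp hq hA hqm
  obtain ⟨M₁, hM₁, HM₁⟩ := exists_lintegral_rpow_le hn hs hp hsp hq hA (hqr.trans hk1)
  obtain ⟨M₂, hM₂, HM₂⟩ := exists_lintegral_rpow_le hn hs hp hsp hq hA
    (by linarith : q ≤ k + 1)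
  -- the tolerance for each of the four error terms
  have h2r : (2 : ℝ≥0∞) ^ (r - 1) ≠ ∞ := ENNReal.rpow_ne_top_of_nonneg (by linarith) (by simp)
  set D : ℝ≥0∞ := 1 + 1 + 2 ^ (r - 1) * (1 + 1) with hD
  have hDt : D ≠ ∞ := by
    rw [hD]
    exact ENNReal.add_ne_top.2 ⟨by simp, ENNReal.mul_ne_top h2r (by simp)⟩
  set η := ε / D with hη
  have hη0 : 0 < η := ENNReal.div_pos hε.ne' hDt
  -- the superlevel set
  obtain ⟨c, hc, hcη⟩ := ENNReal.exists_ofReal_rpow_mul_le one_pos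
    (D := 1 + ENNReal.ofReal M₀) (by simp) hη0
  rw [ENNReal.rpow_one] at hcη
  obtain ⟨Ω, hΩ, hΩm, hΩv⟩ := exists_measurable_superset volume {x | c ≤ |K x * V x ^ (-τ)|}
  have hΩt : volume Ω < ∞ := hΩv ▸ hKV c hc
  set B := (∫⁻ x in Ω, ENNReal.ofReal (K x) ^ t) ^ (1 / t) with hB
  have hBt : B ≠ ∞ := ENNReal.rpow_ne_top_of_nonneg (by positivity) (hKt Ω hΩm hΩt).ne
  -- the truncation height
  obtain ⟨δ, hδ, hδη⟩ := ENNReal.exists_ofReal_rpow_mul_le (one_div_pos.2 ht0)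
    (D := ENNReal.ofReal M₂ ^ (1 / t') * B)
    (ENNReal.mul_ne_top (ENNReal.rpow_ne_top_of_nonneg (by positivity) (by simp)) hBt) hη0
  set Λ := δ⁻¹ with hΛ'
  have hΛ : 0 < Λ := inv_pos.2 hδ
  -- the scale of the averages
  set C₃ := ENNReal.ofReal (2 * Λ) ^ (k - 1) *
    ENNReal.ofReal (unitBallVolume n ^ (1 - (p⁻¹).toReal) * 2 ^ ((n : ℝ) + s) /
      unitBallVolume n) * volume Ω ^ (1 - (p⁻¹).toReal) with hC₃
  have hC₃t : C₃ ≠ ∞ := ENNReal.mul_ne_top (ENNReal.mul_ne_top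
    (ENNReal.rpow_ne_top_of_nonneg (by linarith) ENNReal.ofReal_ne_top) ENNReal.ofReal_ne_top)
    (ENNReal.rpow_ne_top_of_nonneg (sub_toReal_inv_nonneg hp) hΩt.ne)
  obtain ⟨h, hh, hhη⟩ := ENNReal.exists_ofReal_rpow_mul_le
    (by positivity : 0 < s * (1 / t')) (D := C₃ ^ (1 / t') * B)
    (ENNReal.mul_ne_top (ENNReal.rpow_ne_top_of_nonneg (by positivity) hC₃t) hBt) hη0
  -- the number of cells
  obtain ⟨δ₂, hδ₂, hδ₂η⟩ := ENNReal.exists_ofReal_rpow_mul_le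
    (by positivity : 0 < 1 / t) (D := ENNReal.ofReal M₁ ^ (1 / t'))
    (ENNReal.rpow_ne_top_of_nonneg (by positivity) (by simp)) hη0
  set e := TopologicalSpace.denseSeq (EuclideanSpace ℝ (Fin n)) with he
  obtain ⟨N, hN⟩ := exists_setLIntegral_diff_iUnion_ball_le
    (TopologicalSpace.denseRange_denseSeq (EuclideanSpace ℝ (Fin n))) hΩt
    (hKt Ω hΩm hΩt).ne hh (ENNReal.ofReal_pos.2 hδ₂)
  set U := ⋃ k ≤ N, Metric.ball (e k) h with hU
  have hUm : MeasurableSet U :=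
    MeasurableSet.iUnion fun k => .iUnion fun _ => Metric.isOpen_ball.measurableSet
  -- Choosing the nearest of the centres `e 0, …, e N` splits `Ω ∩ U` into disjoint measurable
  -- cells; on `U` that centre is within `h`.
  set ind := SimpleFunc.nearestPtInd e N with hind
  have hSm : MeasurableSet (Ω ∩ U) := hΩm.inter hUm
  have hball : ∀ x ∈ Ω ∩ U, x ∈ Metric.ball (e (ind x)) h := by
    rintro x ⟨-, hx⟩
    simp only [hU, Set.mem_iUnion] at hx
    obtain ⟨j, hj, hxj⟩ := hx
    rw [Metric.mem_ball, dist_comm]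
    rw [Metric.mem_ball, dist_comm] at hxj
    have := SimpleFunc.edist_nearestPt_le e x hj
    rw [edist_dist, edist_dist, ENNReal.ofReal_le_ofReal_iff dist_nonneg] at this
    exact this.trans_lt hxj
  refine ⟨N, fun j => (Ω ∩ U) ∩ ind ⁻¹' {j}, Λ, fun j => hSm.inter (ind.measurableSet_preimage _),
    fun j => (measure_mono fun x hx => hx.1.1).trans_lt hΩt, fun u hu => ?_⟩
  set a : ℕ → ℝ := fun j => truncate Λ (⨍ y in Metric.ball (e j) h, u y) with ha
  refine ⟨a, fun j => abs_truncate_le hΛ.le _, ?_⟩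
  have hum := hu.continuous.measurable
  have hκ : AEMeasurable (fun x => ENNReal.ofReal (K x)) volume := hKm.ennreal_ofReal
  have hsum : ∀ x, ∑ j ∈ Finset.range (N + 1), ((Ω ∩ U) ∩ ind ⁻¹' {j}).indicator (fun _ => a j) x =
      (Ω ∩ U).indicator (fun x => a (ind x)) x := by
    intro x
    by_cases hx : x ∈ Ω ∩ U
    · rw [Set.indicator_of_mem hx, Finset.sum_eq_single (ind x)]
      · rw [Set.indicator_of_mem (show x ∈ (Ω ∩ U) ∩ ind ⁻¹' {ind x} from ⟨hx, rfl⟩)]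
      · intro j _ hj
        exact Set.indicator_of_notMem (fun h' => hj (Eq.symm h'.2)) _
      · intro h'
        exact absurd (Finset.mem_range_succ_iff.2 (SimpleFunc.nearestPtInd_le e N x)) h'
    · rw [Set.indicator_of_notMem hx]
      exact Finset.sum_eq_zero fun j _ => Set.indicator_of_notMem (fun h' => hx h'.1) _
  simp_rw [hsum]
  have hfm : Measurable fun x => a (ind x) := (measurable_of_countable a).comp ind.measurable
  have E1 : ∫⁻ x in Ωᶜ, ‖u x - (Ω ∩ U).indicator (fun x => a (ind x)) x‖ₑ ^ r *
      ENNReal.ofReal (K x) ≤ η := by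
    calc _ = ∫⁻ x in Ωᶜ, ‖u x‖ₑ ^ r * ENNReal.ofReal (K x) := by
          refine setLIntegral_congr_fun hΩm.compl fun x hx => ?_
          simp only [Set.indicator_of_notMem (fun h' : x ∈ Ω ∩ U => hx h'.1), sub_zero]
      _ ≤ _ := setLIntegral_compl_rpow_mul_le hV hm hc hΩm hΩ hum
      _ ≤ ENNReal.ofReal c * (1 + ENNReal.ofReal M₀) := by
          gcongr
          · exact hu.lintegral_weight_le
          · exact HM₀ u hum hu.gagliardo_le hu.lintegral_le
      _ ≤ η := hcη
  have E2 : ∫⁻ x in Ω \ U, ‖u x - (Ω ∩ U).indicator (fun x => a (ind x)) x‖ₑ ^ r *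
      ENNReal.ofReal (K x) ≤ η := by
    calc _ = ∫⁻ x in Ω \ U, ‖u x‖ₑ ^ r * ENNReal.ofReal (K x) := by
          refine setLIntegral_congr_fun (hΩm.diff hUm) fun x hx => ?_
          simp only [Set.indicator_of_notMem (fun h' : x ∈ Ω ∩ U => hx.2 h'.2), sub_zero]
      _ ≤ _ := setLIntegral_rpow_mul_le_holder htt hum.enorm.aemeasurable hκ _
      _ ≤ ENNReal.ofReal M₁ ^ (1 / t') * ENNReal.ofReal δ₂ ^ (1 / t) := by
          gcongr
          exact (setLIntegral_le_lintegral _ _).trans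
            (HM₁ u hum hu.gagliardo_le hu.lintegral_le)
      _ ≤ η := by rwa [mul_comm]
  have E3 : ∫⁻ x in Ω ∩ U, ‖u x - truncate Λ (u x)‖ₑ ^ r * ENNReal.ofReal (K x) ≤ η := by
    have hm3 : Measurable fun x => ‖u x - truncate Λ (u x)‖ₑ :=
      (hum.sub ((measurable_truncate Λ).comp hum)).enorm
    calc _ ≤ _ := setLIntegral_rpow_mul_le_holder htt hm3.aemeasurable hκ _
      _ ≤ (ENNReal.ofReal δ * ENNReal.ofReal M₂) ^ (1 / t') * B := by
          gcongr
          · calc _ ≤ ∫⁻ x, ENNReal.ofReal δ * ‖u x‖ₑ ^ (k + 1) := by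
                  refine (setLIntegral_le_lintegral _ _).trans (lintegral_mono fun x => ?_)
                  have := enorm_sub_truncate_rpow_le hΛ (by linarith : 0 < k) (u x)
                  rwa [hΛ', inv_inv] at this
              _ ≤ _ := by
                  rw [lintegral_const_mul _ (by fun_prop)]
                  gcongr
                  exact HM₂ u hum hu.gagliardo_le hu.lintegral_le
          · exact ENNReal.rpow_le_rpow (lintegral_mono_set Set.inter_subset_left) (by positivity)
      _ ≤ η := by
          rw [ENNReal.mul_rpow_of_nonneg _ _ (by positivity), mul_assoc]
          exact hδη
  have E4 : ∫⁻ x in Ω ∩ U, ‖truncate Λ (u x) - a (ind x)‖ₑ ^ r * ENNReal.ofReal (K x) ≤ η := by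
    have hm4 : Measurable fun x => ‖truncate Λ (u x) - a (ind x)‖ₑ :=
      (((measurable_truncate Λ).comp hum).sub hfm).enorm
    calc _ ≤ _ := setLIntegral_rpow_mul_le_holder htt hm4.aemeasurable hκ _
      _ ≤ (ENNReal.ofReal (h ^ s) * C₃) ^ (1 / t') * B := by
          gcongr
          · exact setLIntegral_truncate_sub_rpow_le hs hp hu.continuous hu.gagliardo_le hΛ.le
              (hr.trans hk1) hh Set.inter_subset_left (z := fun x => e (ind x)) hball
          · exact ENNReal.rpow_le_rpow (lintegral_mono_set Set.inter_subset_left) (by positivity)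
      _ ≤ η := by
          rw [ENNReal.mul_rpow_of_nonneg _ _ (by positivity), mul_assoc,
            ← ENNReal.ofReal_rpow_of_pos hh, ← ENNReal.rpow_mul]
          exact hhη
  have E5 : ∫⁻ x in Ω ∩ U, ‖u x - (Ω ∩ U).indicator (fun x => a (ind x)) x‖ₑ ^ r *
      ENNReal.ofReal (K x) ≤ 2 ^ (r - 1) * (η + η) := by
    calc _ ≤ ∫⁻ x in Ω ∩ U, 2 ^ (r - 1) *
          (‖u x - truncate Λ (u x)‖ₑ ^ r * ENNReal.ofReal (K x) +
            ‖truncate Λ (u x) - a (ind x)‖ₑ ^ r * ENNReal.ofReal (K x)) := by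
          refine setLIntegral_mono' hSm fun x hx => ?_
          rw [Set.indicator_of_mem hx, ← add_mul, ← mul_assoc]
          gcongr
          refine le_trans ?_ (ENNReal.rpow_add_le_mul_rpow_add_rpow _ _ hr)
          gcongr
          simpa using enorm_add_le (u x - truncate Λ (u x)) (truncate Λ (u x) - a (ind x))
      _ = 2 ^ (r - 1) * ((∫⁻ x in Ω ∩ U, ‖u x - truncate Λ (u x)‖ₑ ^ r * ENNReal.ofReal (K x)) +
            ∫⁻ x in Ω ∩ U, ‖truncate Λ (u x) - a (ind x)‖ₑ ^ r * ENNReal.ofReal (K x)) := by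
          rw [lintegral_const_mul' _ _ h2r, lintegral_add_left']
          exact (((hum.sub ((measurable_truncate Λ).comp hum)).enorm.pow_const
            r).aemeasurable.mul hκ).restrict
      _ ≤ _ := by gcongr
  rw [← lintegral_add_compl _ hΩm, ← lintegral_inter_add_sdiff _ Ω hUm]
  calc _ ≤ 2 ^ (r - 1) * (η + η) + η + η := by gcongr
    _ = D * η := by rw [hD]; ring
    _ ≤ ε := ENNReal.mul_div_le

/-! ### Weighted measures and the test space -/

theorem lintegral_weightedVolume {n : ℕ} {w : EuclideanSpace ℝ (Fin n) → ℝ}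
    (hw : AEMeasurable w volume) {f : EuclideanSpace ℝ (Fin n) → ℝ≥0∞}
    (hf : AEMeasurable f volume) :
    ∫⁻ x, f x ∂(weightedVolume w) = ∫⁻ x, f x * ENNReal.ofReal (w x) := by
  rw [weightedVolume, lintegral_withDensity_eq_lintegral_mul₀ hw.ennreal_ofReal hf]
  simp only [Pi.mul_apply, mul_comm]

theorem weightedVolume_absolutelyContinuous {n : ℕ} (w : EuclideanSpace ℝ (Fin n) → ℝ) :
    weightedVolume w ≪ volume :=
  withDensity_absolutelyContinuous _ _

theorem absolutelyContinuous_weightedVolume {n : ℕ} {w : EuclideanSpace ℝ (Fin n) → ℝ}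
    (hw : AEMeasurable w volume) (h0 : ∀ x, 0 < w x) : volume ≪ weightedVolume w :=
  withDensity_absolutelyContinuous' hw.ennreal_ofReal
    (.of_forall fun x => (ENNReal.ofReal_pos.2 (h0 x)).ne')

namespace MVTest

variable {n : ℕ} {s : ℝ} {q p : ℝ≥0∞} {V : EuclideanSpace ℝ (Fin n) → ℝ}

theorem continuous_toFun (u : MVTest n s q p V) : Continuous u.toFun :=
  (show ContDiff ℝ 1 u.toFun from u.2.1).continuous

theorem hasCompactSupport_toFun (u : MVTest n s q p V) : HasCompactSupport u.toFun :=
  u.2.2.1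

theorem memLp_toFun (u : MVTest n s q p V) : MemLp u.toFun q (weightedVolume V) :=
  u.2.2.2.1

theorem memLp_gagliardoQuotient (u : MVTest n s q p V) :
    MemLp (gagliardoQuotient n s p u.toFun) p volume :=
  u.2.2.2.2

theorem norm_eq [Fact (1 ≤ q)] [Fact (1 ≤ p)] (u : MVTest n s q p V) :
    ‖u‖ = (eLpNorm u.toFun q (weightedVolume V)).toReal +
      (eLpNorm (gagliardoQuotient n s p u.toFun) p volume).toReal :=
  rfl

theorem ofReal_norm_eq [Fact (1 ≤ q)] [Fact (1 ≤ p)] (u : MVTest n s q p V) :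
    ENNReal.ofReal ‖u‖ = eLpNorm u.toFun q (weightedVolume V) +
      eLpNorm (gagliardoQuotient n s p u.toFun) p volume := by
  rw [norm_eq, ENNReal.ofReal_add ENNReal.toReal_nonneg ENNReal.toReal_nonneg,
    ENNReal.ofReal_toReal u.memLp_toFun.2.ne, ENNReal.ofReal_toReal u.memLp_gagliardoQuotient.2.ne]

theorem isUnitTestFunction [Fact (1 ≤ q)] [Fact (1 ≤ p)] (hq : q ≠ ∞)
    (hVm : AEMeasurable V volume) {V₀ : ℝ} (hV₀ : 0 < V₀) (hV : ∀ x, V₀ ≤ V x)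
    {u : MVTest n s q p V} (hu : ‖u‖ ≤ 1) :
    IsUnitTestFunction s p q.toReal V₀⁻¹ V u.toFun := by
  have hq0 : q ≠ 0 := (one_pos.trans_le (Fact.out : 1 ≤ q)).ne'
  have hu' := ENNReal.ofReal_le_ofReal hu
  rw [ofReal_norm_eq, ENNReal.ofReal_one] at hu'
  have hm := u.continuous_toFun.measurable
  have h1 : ∫⁻ x, ‖u.toFun x‖ₑ ^ q.toReal * ENNReal.ofReal (V x) ≤ 1 := by
    have h2 := (le_self_add).trans hu'
    rw [eLpNorm_eq_lintegral_rpow_enorm_toReal hq0 hq, one_div,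
      ENNReal.rpow_inv_le_iff (ENNReal.toReal_pos hq0 hq), ENNReal.one_rpow,
      lintegral_weightedVolume hVm (by fun_prop)] at h2
    exact h2
  refine ⟨u.continuous_toFun, (le_add_self).trans hu', h1, ?_⟩
  rw [ENNReal.ofReal_inv_of_pos hV₀, ← one_div, ENNReal.le_div_iff_mul_le (by simp [hV₀]) (by simp),
    ← lintegral_mul_const _ (by fun_prop)]
  refine (lintegral_mono fun x => ?_).trans h1
  gcongr
  exact hV x

theorem exists_linearMap_toLp {r : ℝ≥0∞} {μ : Measure (EuclideanSpace ℝ (Fin n))}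
    (h : ∀ u : MVTest n s q p V, MemLp u.toFun r μ) :
    ∃ J : MVTest n s q p V →ₗ[ℝ] Lp ℝ r μ, ∀ u, J u =ᵐ[μ] u.toFun :=
  ⟨{ toFun := fun u => (h u).toLp u.toFun
     map_add' := fun u v => MemLp.toLp_add (h u) (h v)
     map_smul' := fun c u => MemLp.toLp_const_smul c (h u) },
    fun u => (h u).coeFn_toLp⟩

/-- A Cauchy sequence of test functions which tends to zero almost everywhere tends to zero in
norm. -/
theorem tendsto_norm_of_cauchySeq_of_ae [Fact (1 ≤ q)] [Fact (1 ≤ p)]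
    {u : ℕ → MVTest n s q p V} (hu : CauchySeq u)
    (hae : ∀ᵐ x, Filter.Tendsto (fun k => (u k).toFun x) Filter.atTop (nhds 0)) :
    Filter.Tendsto (fun k => ‖u k‖) Filter.atTop (nhds 0) := by
  rw [Metric.tendsto_atTop]
  intro ε hε
  obtain ⟨N, hN⟩ := Metric.cauchySeq_iff.1 hu (ε / 3) (by positivity)
  refine ⟨N, fun k hk => ?_⟩
  rw [Real.dist_0_eq_abs, abs_of_nonneg (norm_nonneg _)]
  have hle : ∀ᶠ j in Filter.atTop,
      eLpNorm (u k - u j).toFun q (weightedVolume V) +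
        eLpNorm (gagliardoQuotient n s p (u k - u j).toFun) p volume ≤ ENNReal.ofReal (ε / 3) := by
    filter_upwards [Filter.eventually_ge_atTop N] with j hj
    rw [← ofReal_norm_eq, ← dist_eq_norm]
    exact ENNReal.ofReal_le_ofReal (hN k hk j hj).le
  have hlim : ∀ᵐ x, Filter.Tendsto (fun j => (u k - u j).toFun x) Filter.atTop
      (nhds ((u k).toFun x)) := by
    filter_upwards [hae] with x hx
    have h := (tendsto_const_nhds (x := (u k).toFun x)).sub hx
    rwa [sub_zero] at h
  -- Fatou in `j` with `k` fixed: `u k - u j` tends to `u k` almost everywhere while its norm stays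
  -- below `ε / 3`.
  have h1 : eLpNorm (u k).toFun q (weightedVolume V) ≤ ENNReal.ofReal (ε / 3) := by
    refine (Lp.eLpNorm_lim_le_liminf_eLpNorm
      (fun j => (u k - u j).continuous_toFun.aestronglyMeasurable) _
      (weightedVolume_absolutelyContinuous V hlim)).trans ?_
    refine Filter.liminf_le_of_le (by isBoundedDefault) fun b hb => ?_
    obtain ⟨j, hj1, hj2⟩ := (hb.and hle).exists
    exact hj1.trans (le_self_add.trans hj2)
  have h2 : eLpNorm (gagliardoQuotient n s p (u k).toFun) p volume ≤ ENNReal.ofReal (ε / 3) := by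
    -- Pairs with a coordinate in the exceptional null set form a null set of the product.
    have hlim2 : ∀ᵐ z ∂(volume : Measure (EuclideanSpace ℝ (Fin n) × EuclideanSpace ℝ (Fin n))),
        Filter.Tendsto (fun j => gagliardoQuotient n s p (u k - u j).toFun z) Filter.atTop
          (nhds (gagliardoQuotient n s p (u k).toFun z)) := by
      filter_upwards [Measure.quasiMeasurePreserving_fst.ae hlim,
        Measure.quasiMeasurePreserving_snd.ae hlim] with z hz1 hz2
      exact (hz1.sub hz2).div_const _
    refine (Lp.eLpNorm_lim_le_liminf_eLpNorm
      (fun j => (u k - u j).memLp_gagliardoQuotient.1) _ hlim2).trans ?_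
    refine Filter.liminf_le_of_le (by isBoundedDefault) fun b hb => ?_
    obtain ⟨j, hj1, hj2⟩ := (hb.and hle).exists
    exact hj1.trans (le_add_self.trans hj2)
  have h3 := add_le_add h1 h2
  rw [← ofReal_norm_eq, ← ENNReal.ofReal_add (by positivity) (by positivity),
    ENNReal.ofReal_le_ofReal_iff (by positivity)] at h3
  linarith

end MVTest

/-! ### Total boundedness, completion and step functions in `L^r(K)` -/

theorem totallyBounded_of_forall_exists_isCompact {α : Type*} [PseudoMetricSpace α] {S : Set α}
    (h : ∀ ε > 0, ∃ C : Set α, IsCompact C ∧ ∀ x ∈ S, ∃ y ∈ C, dist x y ≤ ε) :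
    TotallyBounded S := by
  rw [Metric.totallyBounded_iff]
  intro ε hε
  obtain ⟨C, hC, hSC⟩ := h (ε / 2) (by positivity)
  obtain ⟨t, ht, hCt⟩ := Metric.totallyBounded_iff.1 hC.totallyBounded (ε / 2) (by positivity)
  refine ⟨t, ht, fun x hx => ?_⟩
  obtain ⟨y, hy, hxy⟩ := hSC x hx
  obtain ⟨z, hz, hyz⟩ := Set.mem_iUnion₂.1 (hCt hy)
  refine Set.mem_iUnion₂.2 ⟨z, hz, ?_⟩
  rw [Metric.mem_ball] at *
  linarith [dist_triangle x y z]

/-- A compact operator on a seminormed space extends to a compact operator on the completion. -/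
theorem IsCompactOperator.exists_extension_completion {E F : Type*} [SeminormedAddCommGroup E]
    [NormedSpace ℝ E] [NormedAddCommGroup F] [NormedSpace ℝ F] [CompleteSpace F] {T : E →ₗ[ℝ] F}
    (hT : IsCompactOperator T) :
    ∃ J : UniformSpace.Completion E →L[ℝ] F, (∀ x : E, J x = T x) ∧ IsCompactOperator J := by
  let T' : E →L[ℝ] F := ContinuousLinearMap.mkOfIsCompactOperator hT
  let J : UniformSpace.Completion E →L[ℝ] F := T'.extend UniformSpace.Completion.toComplL
  have hJ : ∀ x : E, J x = T x := fun x =>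
    T'.extend_eq UniformSpace.Completion.denseRange_coe
      (UniformSpace.Completion.isUniformInducing_coe E) x
  refine ⟨J, hJ, ?_⟩
  rw [← ContinuousLinearMap.coe_coe, isCompactOperator_iff_image_ball_subset_compact _ one_pos]
  refine ⟨_, hT.isCompact_closure_image_ball 1, ?_⟩
  -- The open ball is the part that density reaches: each of its points is a limit of elements of
  -- `E` in the same ball.
  have h1 : Metric.ball (0 : UniformSpace.Completion E) 1 ⊆
      closure (Metric.ball 0 1 ∩ Set.range ((↑) : E → UniformSpace.Completion E)) :=
    UniformSpace.Completion.denseRange_coe.open_subset_closure_inter Metric.isOpen_ball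
  refine (Set.image_mono h1).trans ((image_closure_subset_closure_image J.continuous).trans ?_)
  refine closure_mono ?_
  rintro _ ⟨_, ⟨hx, x, rfl⟩, rfl⟩
  refine ⟨x, ?_, (hJ x).symm⟩
  simpa using hx

/-- The exponent `min t 2` is finite even for `t = ∞`, still exceeds 1, and is admissible because
`Ω` has finite measure. -/
theorem exists_setLIntegral_rpow_lt_top {n : ℕ} {t : ℝ≥0∞} (ht : 1 < t)
    {K : EuclideanSpace ℝ (Fin n) → ℝ} (hK0 : ∀ x, 0 < K x)
    (hKt : ∀ Ω : Set (EuclideanSpace ℝ (Fin n)), MeasurableSet Ω → volume Ω < ∞ →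
      MemLp K t (volume.restrict Ω)) :
    ∃ t' : ℝ, 1 < t' ∧ ∀ Ω : Set (EuclideanSpace ℝ (Fin n)), MeasurableSet Ω → volume Ω < ∞ →
      ∫⁻ x in Ω, ENNReal.ofReal (K x) ^ t' < ∞ := by
  have h1 : 1 < min t 2 := lt_min ht (by norm_num)
  have htop : min t 2 ≠ ∞ := ne_top_of_le_ne_top (by simp) (min_le_right t 2)
  refine ⟨(min t 2).toReal, ?_, fun Ω hΩ hΩt => ?_⟩
  · rw [← ENNReal.toReal_one]
    exact (ENNReal.toReal_lt_toReal (by simp) htop).2 h1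
  · have : IsFiniteMeasure (volume.restrict Ω) := ⟨by simpa using hΩt⟩
    have h2 := lintegral_rpow_enorm_lt_top_of_eLpNorm_lt_top (one_pos.trans h1).ne' htop
      ((hKt Ω hΩ hΩt).mono_exponent (min_le_left t 2)).2
    simpa only [Real.enorm_of_nonneg (hK0 _).le] using h2

theorem weightedVolume_lt_top {n : ℕ} {t : ℝ≥0∞} (ht : 1 ≤ t)
    {K : EuclideanSpace ℝ (Fin n) → ℝ} (hK0 : ∀ x, 0 < K x)
    {Ω : Set (EuclideanSpace ℝ (Fin n))} (hΩ : MeasurableSet Ω) (hΩt : volume Ω < ∞)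
    (hKt : MemLp K t (volume.restrict Ω)) : weightedVolume K Ω < ∞ := by
  have : IsFiniteMeasure (volume.restrict Ω) := ⟨by simpa using hΩt⟩
  have h := (memLp_one_iff_integrable.1 (hKt.mono_exponent ht)).2
  rw [weightedVolume, withDensity_apply _ hΩ]
  simpa only [HasFiniteIntegral, Real.enorm_of_nonneg (hK0 _).le] using h

/-- The whole cube in `ℕ → ℝ` is compact by Tychonoff, and the sum depends continuously on finitely
many coordinates. -/
theorem isCompact_image_sum_smul {F : Type*} [NormedAddCommGroup F] [NormedSpace ℝ F] (N : ℕ)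
    (e : ℕ → F) (Λ : ℝ) :
    IsCompact ((fun a : ℕ → ℝ => ∑ k ∈ Finset.range N, a k • e k) ''
      Set.pi Set.univ fun _ => Set.Icc (-Λ) Λ) :=
  (isCompact_univ_pi fun _ => isCompact_Icc).image (by fun_prop)

theorem coeFn_sum_smul_indicatorConstLp {α : Type*} [MeasurableSpace α] {μ : Measure α} {r : ℝ≥0∞}
    (N : ℕ) {Q : ℕ → Set α} (hQ : ∀ k, MeasurableSet (Q k)) (hμ : ∀ k, μ (Q k) ≠ ∞) (a : ℕ → ℝ) :
    (∑ k ∈ Finset.range N, a k • indicatorConstLp r (hQ k) (hμ k) (1 : ℝ) : Lp ℝ r μ) =ᵐ[μ]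
      fun x => ∑ k ∈ Finset.range N, (Q k).indicator (fun _ => a k) x := by
  induction N with
  | zero =>
    simp only [Finset.range_zero, Finset.sum_empty]
    exact Lp.coeFn_zero ℝ r μ
  | succ N ih =>
    rw [Finset.sum_range_succ]
    filter_upwards [ih, Lp.coeFn_add (∑ k ∈ Finset.range N,
      a k • indicatorConstLp r (hQ k) (hμ k) (1 : ℝ)) (a N • indicatorConstLp r (hQ N) (hμ N) 1),
      Lp.coeFn_smul (a N) (indicatorConstLp r (hQ N) (hμ N) (1 : ℝ)),
      indicatorConstLp_coeFn (p := r) (hs := hQ N) (hμs := hμ N) (c := (1 : ℝ))] with x h1 h2 h3 h4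
    rw [h2, Pi.add_apply, h1, h3, Pi.smul_apply, h4, Finset.sum_range_succ]
    congr 1
    by_cases hx : x ∈ Q N <;> simp [hx]

theorem edist_sum_smul_indicatorConstLp {α : Type*} [MeasurableSpace α] {μ : Measure α} {r : ℝ≥0∞}
    [Fact (1 ≤ r)] (N : ℕ) {Q : ℕ → Set α} (hQ : ∀ k, MeasurableSet (Q k))
    (hμ : ∀ k, μ (Q k) ≠ ∞) (a : ℕ → ℝ) {f : Lp ℝ r μ} {u : α → ℝ} (hf : f =ᵐ[μ] u) :
    edist f (∑ k ∈ Finset.range N, a k • indicatorConstLp r (hQ k) (hμ k) (1 : ℝ)) =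
      eLpNorm (fun x => u x - ∑ k ∈ Finset.range N, (Q k).indicator (fun _ => a k) x) r μ := by
  rw [Lp.edist_def]
  exact eLpNorm_congr_ae (hf.sub (coeFn_sum_smul_indicatorConstLp N hQ hμ a))

/-! ### The compact embedding -/

theorem theorem9 (n : ℕ) (hn : 2 ≤ n) (s : ℝ) (hs0 : 0 < s) (hs1 : s < 1)
    (p q r t : ℝ≥0∞) [Fact (1 ≤ p)] [Fact (1 ≤ q)] [Fact (1 ≤ r)]
    (hsp : (n : ℝ≥0∞) ≤ ENNReal.ofReal s * p) (hqr : q ≤ r) (hr : r < ∞) (ht : 1 < t)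
    (K V : EuclideanSpace ℝ (Fin n) → ℝ)
    (hKm : AEMeasurable K volume) (hVm : AEMeasurable V volume)
    (hK0 : ∀ x, 0 < K x) (hV0 : ∃ V₀ : ℝ, 0 < V₀ ∧ ∀ x, V₀ ≤ V x)
    (hKt : ∀ Ω : Set (EuclideanSpace ℝ (Fin n)), MeasurableSet Ω → volume Ω < ∞ →
      MemLp K t (volume.restrict Ω))
    (τ : ℝ) (hτ : (q < r ∧ 0 < τ ∧ τ < 1) ∨ (q = r ∧ τ = 1))
    (hKV : VanishesAtInfinity (fun x => K x * V x ^ (-τ))) :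
    ∃ J : MVSpace n s q p V →L[ℝ] Lp ℝ r (weightedVolume K),
      (∀ u : MVTest n s q p V, J (u : MVSpace n s q p V) =ᵐ[volume] u.toFun) ∧
      Function.Injective J ∧ IsCompactOperator J := by
  obtain ⟨V₀, hV₀, hV⟩ := hV0
  have hq1 : 1 ≤ q := Fact.out
  have hp1 : 1 ≤ p := Fact.out
  have hr1 : 1 ≤ r := Fact.out
  have hqt : q ≠ ∞ := (hqr.trans_lt hr).ne
  have hr0 : r ≠ 0 := (one_pos.trans_le hr1).ne'
  have hrpos : 0 < r.toReal := ENNReal.toReal_pos hr0 hr.ne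
  have hvK : volume ≪ weightedVolume K := absolutelyContinuous_weightedVolume hKm hK0
  have hKvol : ∀ Ω : Set (EuclideanSpace ℝ (Fin n)), MeasurableSet Ω → volume Ω < ∞ →
      weightedVolume K Ω < ∞ := fun Ω hΩ hΩt =>
    weightedVolume_lt_top ht.le hK0 hΩ hΩt (hKt Ω hΩ hΩt)
  -- This places continuous functions of compact support in `L^r(K)`.
  have : IsFiniteMeasureOnCompacts (weightedVolume K) :=
    ⟨fun C hC => hKvol C hC.measurableSet hC.measure_lt_top⟩
  obtain ⟨T, hT⟩ := MVTest.exists_linearMap_toLp (n := n) (s := s) (q := q) (p := p) (V := V)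
    (r := r) (μ := weightedVolume K) fun u =>
      u.continuous_toFun.memLp_of_hasCompactSupport u.hasCompactSupport_toFun
  obtain ⟨t', ht', hKt'⟩ := exists_setLIntegral_rpow_lt_top ht hK0 hKt
  have hτ' : (q.toReal < r.toReal ∧ 0 < τ ∧ τ < 1) ∨ (q.toReal = r.toReal ∧ τ = 1) :=
    hτ.imp (fun h => ⟨(ENNReal.toReal_lt_toReal hqt hr.ne).2 h.1, h.2⟩)
      (fun h => ⟨congrArg _ h.1, h.2⟩)
  have hTc : IsCompactOperator T := by
    rw [isCompactOperator_iff_isCompact_closure_image_ball _ one_pos]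
    refine TotallyBounded.isCompact_of_isClosed (TotallyBounded.closure ?_) isClosed_closure
    refine totallyBounded_of_forall_exists_isCompact fun ε hε => ?_
    obtain ⟨N, Q, Λ, hQm, hQt, H⟩ := exists_uniform_simple_approximation (by omega : n ≠ 0) hs0 hp1
      hsp (q := q.toReal) (r := r.toReal) (A := V₀⁻¹) (V := V)
      (by rw [← ENNReal.toReal_one]; exact ENNReal.toReal_mono hqt hq1)
      (ENNReal.toReal_mono hr.ne hqr) ht' (by positivity) hKm (fun x => hV₀.trans_le (hV x)) hKt'
      hτ' hKV.2 (ε := ENNReal.ofReal ε ^ r.toReal)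
      (ENNReal.rpow_pos (ENNReal.ofReal_pos.2 hε) ENNReal.ofReal_ne_top)
    refine ⟨_, isCompact_image_sum_smul (N + 1)
      (fun k => indicatorConstLp r (hQm k) (hKvol _ (hQm k) (hQt k)).ne (1 : ℝ)) Λ, ?_⟩
    rintro _ ⟨u, hu, rfl⟩
    rw [mem_ball_zero_iff] at hu
    obtain ⟨a, ha, hau⟩ := H u.toFun (u.isUnitTestFunction hqt hVm hV₀ hV hu.le)
    refine ⟨_, ⟨a, fun k _ => abs_le.1 (ha k), rfl⟩, ?_⟩
    rw [← ENNReal.ofReal_le_ofReal_iff hε.le, ← edist_dist,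
      edist_sum_smul_indicatorConstLp (N + 1) hQm (fun k => (hKvol _ (hQm k) (hQt k)).ne) a (hT u),
      eLpNorm_eq_lintegral_rpow_enorm_toReal hr0 hr.ne, one_div,
      ENNReal.rpow_inv_le_iff hrpos, lintegral_weightedVolume hKm]
    · exact hau
    · have hmeas : Measurable fun x =>
          ∑ k ∈ Finset.range (N + 1), (Q k).indicator (fun _ => a k) x :=
        Finset.measurable_fun_sum _ fun k _ => measurable_const.indicator (hQm k)
      exact ((u.continuous_toFun.measurable.sub hmeas).enorm.pow_const _).aemeasurable
  obtain ⟨J, hJT, hJc⟩ := hTc.exists_extension_completion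
  refine ⟨J, fun u => ?_, ?_, hJc⟩
  · rw [hJT]
    exact hvK (hT u)
  · rw [injective_iff_map_eq_zero]
    intro x hx
    obtain ⟨w, hw⟩ : ∃ w : ℕ → MVTest n s q p V, Filter.Tendsto
        (fun k => (w k : MVSpace n s q p V)) Filter.atTop (nhds x) := by
      obtain ⟨v, hv, hvx⟩ := mem_closure_iff_seq_limit.1
        ((UniformSpace.Completion.denseRange_coe (α := MVTest n s q p V)) x)
      choose w hw using hv
      exact ⟨w, by simpa only [hw] using hvx⟩
    have hwc : CauchySeq w := by
      have h := hw.cauchySeq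
      rwa [CauchySeq, ← Function.comp_def, ← Filter.map_map,
        (UniformSpace.Completion.isUniformInducing_coe (MVTest n s q p V)).cauchy_map_iff] at h
    have hTw : Filter.Tendsto (fun k => T (w k)) Filter.atTop (nhds 0) := by
      have h := (J.continuous.tendsto x).comp hw
      rw [hx] at h
      exact h.congr fun k => hJT (w k)
    -- Only a subsequence converges almost everywhere, but it still represents `x`, and its norms
    -- tend both to `‖x‖` and to zero.
    obtain ⟨ns, hns, hae⟩ := (tendstoInMeasure_of_tendsto_Lp hTw).exists_seq_tendsto_ae
    have hae' : ∀ᵐ y, Filter.Tendsto (fun i => (w (ns i)).toFun y) Filter.atTop (nhds 0) := by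
      refine hvK ?_
      filter_upwards [hae, ae_all_iff.2 fun k => hT (w k), Lp.coeFn_zero ℝ r (weightedVolume K)]
        with y h1 h2 h3
      rw [h3, Pi.zero_apply] at h1
      exact h1.congr fun i => h2 (ns i)
    have h0 := MVTest.tendsto_norm_of_cauchySeq_of_ae
      (hwc.comp_tendsto hns.tendsto_atTop) hae'
    have h1 := (hw.comp hns.tendsto_atTop).norm
    refine norm_eq_zero.1 (tendsto_nhds_unique h1 (h0.congr fun i => ?_))
    exact (UniformSpace.Completion.norm_coe (w (ns i))).symm
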